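/- Let $J_0$ be a real constant. For $S\in\{\tfrac12,1,\tfrac32,\dots\}$ and $N$ sites consider on $(\mathbb C^{2S+1})^{\otimes N}$ the Hamiltonian $$\hat H(t)=-\frac1{2S}\sum_{i,j=1}^N\sum_{\alpha,\beta\in\{x,y,z\}}J_{ij}^{\alpha\beta}(t)\,\hat S_i^\alpha\hat S_j^\beta-\sum_{i=1}^N \boldsymbol h_i(t)\cdot\hat{\boldsymbol S}_i ,$$ where $\hat{\boldsymbol S}_i$ are the standard spin-$S$ operators at site $i$ ($\hbar=1$), and, for $t\ge 0$, the functions $J_{ij}^{\alpha\beta}(t)=J_{ji}^{\beta\alpha}(t)$ and $\boldsymbol h_i(t)$ are real and locally integrable in $t$ with $$\sum_{\alpha,\beta}\sum_{j}|J_{ij}^{\alpha\beta}(t)|\le J_0\qquad\text{for all } i \text{ and } t\ge 0 .$$ Let $|\Psi_S(t)\rangle$, $t\ge0$, solve $i\,\frac{d}{dt}|\Psi_S\rangle=\hat H(t)|\Psi_S\rangle$ with a factorized classical initial state $|\Psi_S(0)\rangle=\bigotimes_i|\psi_{S,i}\rangle$, i.e. each $\psi_{S,i}$ is a unit vector and $|\langle\psi_{S,i}|\hat{\boldsymbol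 S}_i|\psi_{S,i}\rangle|=S$. The classical equations of motion are $$\frac{d}{dt}\boldsymbol s_i(t)=\boldsymbol s_i(t)\times\tilde{\boldsymbol h}_i(t),\qquad \tilde h_i^\alpha(t)=h_i^\alpha(t)+\sum_{j}\sum_{\beta}J_{ij}^{\alpha\beta}(t)\,s_j^\beta(t).$$ Both evolution equations are understood for continuous functions of $t\ge0$ in integrated form. (1) Let $N$, $J$, $\boldsymbol h$ be fixed (independent of $S$), and suppose that $\frac1S\langle\Psi_S(0)|\hat{\boldsymbol S}_i|\Psi_S(0)\rangle\to\boldsymbol s_i^{0}$ as $S\to\infty$ for each $i$ (for example, that the initial directions do not depend on $S$). Then the classical equations have exactly one solution on $[0,\infty)$ with $\boldsymbol s_i(0)=\boldsymbol s_i^0$; the differential equation holds pointwise at each $t\ge 0$ at which $J$ and $\boldsymbol h$ are continuous as functions on $[0,\infty)$ (with the right derivative at $t=0$); and for every fixed $t\ge0$, all $n$, all sites $i_1,\dots,i_n$ (not necessarily distinct) and all components $\alpha_1,\dots,\alpha_n$, $$\lim_{S\to\infty}\frac1S\langle\Psi_S(t)|\hat{\boldsymbol S}_i|\Psi_S(t)\rangle=\boldsymbol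 s_i(t),\qquad \lim_{S\to\infty}\frac1{S^n}\langle\Psi_S(t)|\hat S_{i_1}^{\alpha_1}\cdots\hat S_{i_n}^{\alpha_n}|\Psi_S(t)\rangle=s_{i_1}^{\alpha_1}(t)\cdots s_{i_n}^{\alpha_n}(t).$$ (2) The convergence is uniform given $J_0$: for all $n$, $T$ and $\varepsilon>0$ there is an $S_0$ such that for all $S\ge S_0$, all $N$, all $J,\boldsymbol h$ as above (possibly depending on $S$), all factorized classical initial states, all sites and components and all $t\in[0,T]$, $$\Big|\frac1{S^n}\langle\Psi_S(t)|\hat S_{i_1}^{\alpha_1}\cdots\hat S_{i_n}^{\alpha_n}|\Psi_S(t)\rangle-s_{i_1}^{\alpha_1}(t)\cdots s_{i_n}^{\alpha_n}(t)\Big|\le\varepsilon ,$$ where $\boldsymbol s$ is the solution of the classical equations with $\boldsymbol s_i(0)=\frac1S\langle\Psi_S(0)|\hat{\boldsymbol S}_i|\Psi_S(0)\rangle$. -/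

import Mathlib

open Filter Topology MeasureTheory
open scoped Matrix

noncomputable section

namespace LargeSpin

/-- The spin value `S = m / 2`; half-integer and integer spins are labelled by `m = 2S`. -/
def spinVal (m : ℕ) : ℝ := (m : ℝ) / 2

/-- The Hilbert space `ℂ^(2S+1)` of one spin `S = m / 2`. The `k`-th basis vector is the
eigenvector of `S^z` with eigenvalue `S - k`. -/
abbrev SiteSpace (m : ℕ) : Type := EuclideanSpace ℂ (Fin (m + 1))

/-- The Hilbert space `(ℂ^(2S+1))^{⊗ N}` of `N` spins `S = m / 2`, in the product basis. -/
abbrev ChainSpace (N m : ℕ) : Type := EuclideanSpace ℂ (Fin N → Fin (m + 1))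

/-- Matrices on one spin. -/
abbrev SiteMatrix (m : ℕ) : Type := Matrix (Fin (m + 1)) (Fin (m + 1)) ℂ

/-- Matrices on `N` spins. -/
abbrev ChainMatrix (N m : ℕ) : Type :=
  Matrix (Fin N → Fin (m + 1)) (Fin N → Fin (m + 1)) ℂ

/-- The raising matrix `S^+ = S^x + i S^y` of a spin `S = m / 2`: with `M = S - l`,
`S^+ |M⟩ = √((S - M)(S + M + 1)) |M + 1⟩ = √(l (m + 1 - l)) |M + 1⟩`. -/
def raiseMatrix (m : ℕ) : SiteMatrix m :=
  fun k l => if (k : ℕ) + 1 = (l : ℕ) then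
    ((Real.sqrt ((l : ℕ) * ((m : ℝ) + 1 - (l : ℕ))) : ℝ) : ℂ) else 0

/-- The matrices `S^x, S^y, S^z` (components `0, 1, 2`) of a spin `S = m / 2`. -/
def spinMatrix (m : ℕ) : Fin 3 → SiteMatrix m :=
  ![(1 / 2 : ℂ) • (raiseMatrix m + (raiseMatrix m)ᴴ),
    (1 / (2 * Complex.I) : ℂ) • (raiseMatrix m - (raiseMatrix m)ᴴ),
    Matrix.diagonal fun k => ((spinVal m - (k : ℕ) : ℝ) : ℂ)]

/-- The tensor product `⨂_j A_j` of one-spin matrices. -/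
def tensorMatrix {N m : ℕ} (A : Fin N → SiteMatrix m) : ChainMatrix N m :=
  fun k l => ∏ j, A j (k j) (l j)

/-- The spin operator `S_i^α`, acting as `S^α` at site `i` and as the identity elsewhere. -/
def siteSpin {N : ℕ} (m : ℕ) (i : Fin N) (α : Fin 3) : ChainMatrix N m :=
  tensorMatrix (Pi.mulSingle i (spinMatrix m α))

/-- The product vector `⨂_i ψ_i`. -/
def productState {N m : ℕ} (ψ : Fin N → SiteSpace m) : ChainSpace N m :=
  WithLp.toLp 2 fun k => ∏ i, ψ i (k i)

/-- The expectation `⟨x, A x⟩`. -/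
def expectation {κ : Type*} [Fintype κ] [DecidableEq κ] (A : Matrix κ κ ℂ)
    (x : EuclideanSpace ℂ κ) : ℂ :=
  inner ℂ x (Matrix.toEuclideanLin A x)

/-- The Hamiltonian
`H = -(1/(2S)) ∑_{ij} ∑_{αβ} J_{ij}^{αβ} S_i^α S_j^β - ∑_i ∑_α h_i^α S_i^α`
for given (instantaneous) couplings `J` and fields `h`. -/
def hamiltonian {N : ℕ} (m : ℕ) (J : Fin N → Fin N → Fin 3 → Fin 3 → ℝ)
    (h : Fin N → Fin 3 → ℝ) : ChainMatrix N m :=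
  -((1 / (2 * spinVal m) : ℝ) : ℂ) •
      (∑ i, ∑ j, ∑ α, ∑ β, (J i j α β : ℂ) • (siteSpin m i α * siteSpin m j β))
    - ∑ i, ∑ α, (h i α : ℂ) • siteSpin m i α

/-- The standing assumptions on the time-dependent couplings and fields: the symmetry
`J_{ij}^{αβ} = J_{ji}^{βα}`, the bound `∑_{αβ} ∑_j |J_{ij}^{αβ}(t)| ≤ J₀`, and local
integrability in time, without which the equations of motion have no meaning. (Continuous,
piecewise continuous, and step-like drivings are all allowed.) -/
structure Admissible {N : ℕ} (J₀ : ℝ) (J : ℝ → Fin N → Fin N → Fin 3 → Fin 3 → ℝ)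
    (h : ℝ → Fin N → Fin 3 → ℝ) : Prop where
  symm : ∀ t, 0 ≤ t → ∀ i j α β, J t i j α β = J t j i β α
  bound : ∀ t, 0 ≤ t → ∀ i, ∑ α, ∑ β, ∑ j, |J t i j α β| ≤ J₀
  integrable_coupling : ∀ T, 0 ≤ T → ∀ i j α β,
    IntervalIntegrable (fun t => J t i j α β) volume 0 T
  integrable_field : ∀ T, 0 ≤ T → ∀ i α, IntervalIntegrable (fun t => h t i α) volume 0 T

/-- `Ψ` solves `i dΨ/dt = H(t) Ψ` for `t ≥ 0`, in the integrated form
`Ψ(t) = Ψ(0) - i ∫_0^t H(u) Ψ(u) du`, which makes sense for integrable couplings and is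
equivalent to the differential equation for continuous ones. -/
def IsSchrodingerSolution {N : ℕ} (m : ℕ) (J : ℝ → Fin N → Fin N → Fin 3 → Fin 3 → ℝ)
    (h : ℝ → Fin N → Fin 3 → ℝ) (Ψ : ℝ → ChainSpace N m) : Prop :=
  ContinuousOn Ψ (Set.Ici 0) ∧
    ∀ t, 0 ≤ t →
      Ψ t = Ψ 0 - Complex.I •
        ∫ u in (0 : ℝ)..t, Matrix.toEuclideanLin (hamiltonian m (J u) (h u)) (Ψ u)

/-- A classical (maximally polarized) one-spin state: a unit vector whose spin expectation
`(⟨S^x⟩, ⟨S^y⟩, ⟨S^z⟩)` has the maximal length `S`. -/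
def IsClassicalState {m : ℕ} (ψ : SiteSpace m) : Prop :=
  ‖ψ‖ = 1 ∧ ∑ α, (expectation (spinMatrix m α) ψ).re ^ 2 = spinVal m ^ 2

/-- The effective field `h̃_i^α = h_i^α + ∑_j ∑_β J_{ij}^{αβ} s_j^β`. -/
def effectiveField {N : ℕ} (J : Fin N → Fin N → Fin 3 → Fin 3 → ℝ) (h : Fin N → Fin 3 → ℝ)
    (s : Fin N → Fin 3 → ℝ) (i : Fin N) : Fin 3 → ℝ :=
  fun α => h i α + ∑ j, ∑ β, J i j α β * s j β

/-- The right-hand side `s_i × h̃_i` of the classical equations of motion. -/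
def torque {N : ℕ} (J : Fin N → Fin N → Fin 3 → Fin 3 → ℝ) (h : Fin N → Fin 3 → ℝ)
    (s : Fin N → Fin 3 → ℝ) (i : Fin N) : Fin 3 → ℝ :=
  crossProduct (s i) (effectiveField J h s i)

/-- `s` solves `ds_i/dt = s_i × h̃_i` for `t ≥ 0`, in the integrated form. -/
def IsClassicalTrajectory {N : ℕ} (J : ℝ → Fin N → Fin N → Fin 3 → Fin 3 → ℝ)
    (h : ℝ → Fin N → Fin 3 → ℝ) (s : ℝ → Fin N → Fin 3 → ℝ) : Prop :=
  ContinuousOn s (Set.Ici 0) ∧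
    ∀ t, 0 ≤ t → ∀ i α,
      s t i α = s 0 i α + ∫ u in (0 : ℝ)..t, torque (J u) (h u) (s u) i α

/-- The normalized spin expectation `⟨Ψ, S_i^α Ψ⟩ / S`. -/
def normalizedSpin {N m : ℕ} (Ψ : ChainSpace N m) (i : Fin N) (α : Fin 3) : ℝ :=
  (expectation (siteSpin m i α) Ψ).re / spinVal m

/-- The normalized correlation `S^{-n} ⟨Ψ, S_{i_1}^{α_1} ⋯ S_{i_n}^{α_n} Ψ⟩` (the sites may
coincide; the operators are multiplied in the given order). -/
def normalizedCorrelation {N m n : ℕ} (Ψ : ChainSpace N m) (i : Fin n → Fin N)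
    (α : Fin n → Fin 3) : ℂ :=
  expectation (List.ofFn fun k => siteSpin m (i k) (α k)).prod Ψ / ((spinVal m : ℝ) : ℂ) ^ n

end LargeSpin

end

/-! The quantity to control is the spread of site `i` about the classical spin, D_i = ∑_α ‖(S_i^α/S
- s_i^α)Ψ‖². Because S_i·S_i = S(S+1) is a scalar, D_i equals 1 + 1/S + |s_i|² - (2/S) s_i·⟨S_i⟩,
and |s_i| is conserved. Hence dD_i/dt involves only the torque on s_i and Heisenberg's equation for
S_i (`sum_torque_mul_expectation_add`).

In that derivative the external field cancels. What remains is (2/S) ∑ J_ij^{αβ} Re⟨(S_i × s_i)^α Ψ,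
(S_j^β/S - s_j^β)Ψ⟩. Since s_i × s_i = 0, the left vector is S times a deviation crossed with s_i
(`crossMatrix_deviation`). Each term is therefore bilinear in deviations, and dD_i/dt ≤ 4 J₀ max_j
D_j. Gronwall gives D_i(t) ≤ δ e^{4|J₀|t} when every D_j(0) ≤ δ (`spread_le`), with a rate
independent of N, S and the field. A classical product state has D_i = 1/S about its own mean spin,
whence the uniformity.

Small spread means that S_i^α/S acts on Ψ almost as the number s_i^α. Replacing the factors of a
product of n spin operators one at a time costs at most n 2^n √(max D)
(`norm_prod_siteSpin_sub_le`).

Uniqueness of the classical solution is the same Gronwall argument for |s_i - s'_i|². Existence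
follows from a contraction after the quadratic torque has been made globally Lipschitz by a
retraction that is invisible on unit vectors. As the driving is only integrable in time, all
differentiation is done through integrals. -/

noncomputable section

namespace LargeSpin

/-! ### Calculus of integrals of locally integrable functions -/

section Primitive

variable {E F : Type*} [NormedAddCommGroup E] [NormedSpace ℝ E] [NormedAddCommGroup F]
  [NormedSpace ℝ F]

/-- `f` is a primitive of the locally integrable function `f'` on `[0, ∞)`. -/
structure IsPrimitive (f f' : ℝ → E) : Prop where
  integrable : ∀ t, 0 ≤ t → IntervalIntegrable f' volume 0 t
  eq_add_integral : ∀ t, 0 ≤ t → f t = f 0 + ∫ u in (0 : ℝ)..t, f' u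

namespace IsPrimitive

variable {f g f' g' : ℝ → E}

theorem congr (hf : IsPrimitive f f') (h : ∀ t, 0 ≤ t → f' t = g' t) : IsPrimitive f g' := by
  have key : ∀ t, 0 ≤ t → Set.EqOn f' g' (Set.uIoc 0 t) := fun t ht u hu => by
    rw [Set.uIoc_of_le ht] at hu
    exact h u hu.1.le
  refine ⟨fun t ht => (hf.integrable t ht).congr (key t ht), fun t ht => ?_⟩
  rw [hf.eq_add_integral t ht]
  congr 1
  refine intervalIntegral.integral_congr_ae (ae_of_all _ fun u hu => key t ht hu)

theorem continuousOn (hf : IsPrimitive f f') : ContinuousOn f (Set.Ici 0) := by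
  intro t ht
  have ht1 : (0 : ℝ) ≤ t + 1 := add_nonneg ht zero_le_one
  have h1 := intervalIntegral.continuousOn_primitive_interval' (hf.integrable (t + 1) ht1)
    (Set.left_mem_uIcc)
  rw [Set.uIcc_of_le ht1] at h1
  have h2 : ContinuousOn f (Set.Icc 0 (t + 1)) :=
    (h1.const_add (f 0)).congr fun u hu => hf.eq_add_integral u hu.1
  refine (h2 t ⟨ht, by linarith⟩).mono_of_mem_nhdsWithin ?_
  filter_upwards [self_mem_nhdsWithin, mem_nhdsWithin_of_mem_nhds (Iio_mem_nhds (lt_add_one t))]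
    with u hu hu' using ⟨hu, le_of_lt hu'⟩

theorem add (hf : IsPrimitive f f') (hg : IsPrimitive g g') :
    IsPrimitive (fun t => f t + g t) (fun t => f' t + g' t) where
  integrable t ht := (hf.integrable t ht).add (hg.integrable t ht)
  eq_add_integral t ht := by
    rw [intervalIntegral.integral_add (hf.integrable t ht) (hg.integrable t ht),
      hf.eq_add_integral t ht, hg.eq_add_integral t ht]
    abel

theorem const (c : E) : IsPrimitive (fun _ => c) (fun _ => 0) where
  integrable _ _ := intervalIntegrable_const
  eq_add_integral _ _ := by simp

theorem sum {ι : Type*} (s : Finset ι) {f f' : ι → ℝ → E}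
    (hf : ∀ i ∈ s, IsPrimitive (f i) (f' i)) :
    IsPrimitive (fun t => ∑ i ∈ s, f i t) (fun t => ∑ i ∈ s, f' i t) := by
  classical
  induction s using Finset.induction_on with
  | empty => simpa using const (0 : E)
  | insert a s ha ih =>
    simp only [Finset.sum_insert ha]
    exact (hf a (Finset.mem_insert_self a s)).add
      (ih fun i hi => hf i (Finset.mem_insert_of_mem hi))

variable [CompleteSpace E] [CompleteSpace F]

theorem clm_comp (L : E →L[ℝ] F) (hf : IsPrimitive f f') :
    IsPrimitive (fun t => L (f t)) (fun t => L (f' t)) where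
  integrable t ht :=
    ⟨L.integrable_comp (hf.integrable t ht).1, L.integrable_comp (hf.integrable t ht).2⟩
  eq_add_integral t ht := by
    rw [L.intervalIntegral_comp_comm (hf.integrable t ht), hf.eq_add_integral t ht, map_add]

end IsPrimitive

/-- Primitives of integrable functions are absolutely continuous and almost everywhere
differentiable, so this is integration by parts for absolutely continuous functions. -/
theorem IsPrimitive.mul_real {f g f' g' : ℝ → ℝ} (hf : IsPrimitive f f') (hg : IsPrimitive g g') :
    IsPrimitive (fun t => f t * g t) (fun t => f' t * g t + f t * g' t) := by
  have cont : ∀ {f f' : ℝ → ℝ}, IsPrimitive f f' → ∀ t, 0 ≤ t →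
      ContinuousOn f (Set.uIcc 0 t) := fun hf t ht =>
    hf.continuousOn.mono (by rw [Set.uIcc_of_le ht]; exact Set.Icc_subset_Ici_self)
  refine ⟨fun t ht => ((hf.integrable t ht).mul_continuousOn (cont hg t ht)).add
    ((hg.integrable t ht).continuousOn_mul (cont hf t ht)), fun t ht => ?_⟩
  -- Nothing is known about `f` at negative times, so it is replaced by its integral formula, which
  -- is differentiable in the two-sided sense almost everywhere.
  have key : ∀ {f f' : ℝ → ℝ}, IsPrimitive f f' →
      AbsolutelyContinuousOnInterval (fun u => f 0 + ∫ v in (0 : ℝ)..u, f' v) 0 t ∧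
      ∀ᵐ u, u ∈ Set.uIcc 0 t → HasDerivAt (fun u => f 0 + ∫ v in (0 : ℝ)..u, f' v) (f' u) u := by
    intro f f' hf
    refine ⟨?_, ?_⟩
    · refine AbsolutelyContinuousOnInterval.fun_add ?_
        ((hf.integrable t ht).absolutelyContinuousOnInterval_intervalIntegral Set.left_mem_uIcc)
      exact ((LipschitzWith.const (f 0)).lipschitzOnWith).absolutelyContinuousOnInterval
    · filter_upwards [(hf.integrable t ht).ae_hasDerivAt_integral] with u hu hu'
      exact (hu hu' 0 Set.left_mem_uIcc).const_add _
  have := (key hf).1.integral_deriv_mul_eq_sub (key hg).1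
  rw [← hf.eq_add_integral t ht, ← hg.eq_add_integral t ht] at this
  simp only [intervalIntegral.integral_same, add_zero] at this
  rw [← sub_eq_iff_eq_add', ← this]
  refine intervalIntegral.integral_congr_ae ?_
  filter_upwards [(key hf).2, (key hg).2] with u hu1 hu2 hu
  have hu' := Set.uIoc_subset_uIcc hu
  have hu0 : 0 ≤ u := by
    rw [Set.uIoc_of_le ht] at hu
    exact hu.1.le
  rw [(hu1 hu').deriv, (hu2 hu').deriv, ← hf.eq_add_integral u hu0, ← hg.eq_add_integral u hu0]

theorem IsPrimitive.re {f f' : ℝ → ℂ} (hf : IsPrimitive f f') :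
    IsPrimitive (fun t => (f t).re) (fun t => (f' t).re) :=
  hf.clm_comp Complex.reCLM

theorem IsPrimitive.im {f f' : ℝ → ℂ} (hf : IsPrimitive f f') :
    IsPrimitive (fun t => (f t).im) (fun t => (f' t).im) :=
  hf.clm_comp Complex.imCLM

theorem IsPrimitive.ofReal {f f' : ℝ → ℝ} (hf : IsPrimitive f f') :
    IsPrimitive (fun t => (f t : ℂ)) (fun t => (f' t : ℂ)) :=
  hf.clm_comp Complex.ofRealCLM

theorem IsPrimitive.conj {f f' : ℝ → ℂ} (hf : IsPrimitive f f') :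
    IsPrimitive (fun t => starRingEnd ℂ (f t)) (fun t => starRingEnd ℂ (f' t)) :=
  hf.clm_comp (Complex.conjCLE : ℂ →L[ℝ] ℂ)

theorem IsPrimitive.const_mul {f f' : ℝ → ℂ} (c : ℂ) (hf : IsPrimitive f f') :
    IsPrimitive (fun t => c * f t) (fun t => c * f' t) :=
  hf.clm_comp (ContinuousLinearMap.mul ℝ ℂ c)

theorem IsPrimitive.const_mul_real {f f' : ℝ → ℝ} (c : ℝ) (hf : IsPrimitive f f') :
    IsPrimitive (fun t => c * f t) (fun t => c * f' t) :=
  hf.clm_comp (ContinuousLinearMap.mul ℝ ℝ c)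

theorem IsPrimitive.mul {f g f' g' : ℝ → ℂ} (hf : IsPrimitive f f') (hg : IsPrimitive g g') :
    IsPrimitive (fun t => f t * g t) (fun t => f' t * g t + f t * g' t) := by
  have h1 := ((hf.re.mul_real hg.re).add ((hf.im.mul_real hg.im).const_mul_real (-1))).ofReal
  have h2 := (((hf.re.mul_real hg.im).add (hf.im.mul_real hg.re)).ofReal).const_mul Complex.I
  have h3 := h1.add h2
  convert! h3 using 1 <;> funext t <;> apply Complex.ext <;> simp <;> ring

end Primitive

/-- Gronwall's differential inequality is applied to the right-hand side δ + K∫v rather than to `v`: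
it is differentiable, and its derivative K v is at most K times itself. -/
theorem le_mul_exp_of_le_add_integral {v : ℝ → ℝ} {δ K : ℝ} (hK : 0 ≤ K)
    (hv : ContinuousOn v (Set.Ici 0))
    (h : ∀ t, 0 ≤ t → v t ≤ δ + K * ∫ u in (0 : ℝ)..t, v u) {t : ℝ} (ht : 0 ≤ t) :
    v t ≤ δ * Real.exp (K * t) := by
  -- Constant extension to negative times makes the integral differentiable at 0 as well.
  set w : ℝ → ℝ := fun u => v (max u 0) with hw
  have hwc : Continuous w :=
    hv.comp_continuous (continuous_id.max continuous_const) fun u => Set.mem_Ici.2 (le_max_right _ _)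
  have hwv : ∀ u, 0 ≤ u → w u = v u := fun u hu => by simp [hw, max_eq_left hu]
  have hint : ∀ t, 0 ≤ t → ∫ u in (0 : ℝ)..t, w u = ∫ u in (0 : ℝ)..t, v u := fun t ht =>
    intervalIntegral.integral_congr fun u hu => by
      rw [Set.uIcc_of_le ht] at hu
      exact hwv u hu.1
  have hd : ∀ x, HasDerivAt (fun t => δ + K * ∫ u in (0 : ℝ)..t, w u) (K * w x) x := fun x =>
    ((hwc.integral_hasStrictDerivAt 0 x).hasDerivAt.const_mul K).const_add δ
  have := le_gronwallBound_of_liminf_deriv_right_le (f := fun t => δ + K * ∫ u in (0 : ℝ)..t, w u)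
    (f' := fun x => K * w x) (δ := δ) (K := K) (ε := 0) (a := 0) (b := t)
    (fun x _ => (hd x).continuousAt.continuousWithinAt)
    (fun x _ r hr => (hd x).hasDerivWithinAt.liminf_right_slope_le hr) (by simp)
    (fun x hx => by
      rw [add_zero]
      refine mul_le_mul_of_nonneg_left ?_ hK
      rw [hint x hx.1, hwv x hx.1]
      exact h x hx.1) t ⟨ht, le_rfl⟩
  rw [gronwallBound_ε0, sub_zero] at this
  refine le_trans ?_ this
  simpa only [hint t ht] using h t ht

open scoped NNReal BoundedContinuousFunction

/-! ### Differential equations with integrable time dependence -/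

section Caratheodory

variable {E : Type*} [NormedAddCommGroup E] [NormedSpace ℝ E]

/-- `∫_0^t L e^{2Λ} ≤ e^{2Λ(t)} / 2` for `Λ(t) = ∫_0^t L`. -/
theorem integral_mul_exp_primitive_le {L : ℝ → ℝ}
    (hL : ∀ t, 0 ≤ t → IntervalIntegrable L volume 0 t)
    (hL0 : ∀ t, 0 ≤ t → 0 ≤ L t) {t : ℝ} (ht : 0 ≤ t) :
    ∫ u in (0 : ℝ)..t, L u * Real.exp (2 * ∫ v in (0 : ℝ)..u, L v) ≤
      1 / 2 * Real.exp (2 * ∫ v in (0 : ℝ)..t, L v) := by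
  set F : ℝ → ℝ := fun u => Real.exp (2 * ∫ v in (0 : ℝ)..u, L v) with hF
  have hmono : MonotoneOn F (Set.uIcc 0 t) := by
    rw [Set.uIcc_of_le ht]
    intro a ha b hb hab
    refine Real.exp_le_exp.2 (mul_le_mul_of_nonneg_left ?_ zero_le_two)
    refine intervalIntegral.integral_mono_interval le_rfl ha.1 hab ?_ (hL b hb.1)
    exact (ae_restrict_iff' measurableSet_Ioc).2 (ae_of_all _ fun u hu => hL0 u hu.1.le)
  -- For a monotone function the integral of the derivative is at most the increment, so absolute
  -- continuity of the exponential is not needed.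
  have hle := hmono.intervalIntegral_deriv_mem_uIcc
  have h0 : F 0 = 1 := by simp [hF]
  have hFt : 0 ≤ F t - F 0 :=
    sub_nonneg.2 (hmono Set.left_mem_uIcc Set.right_mem_uIcc ht)
  rw [Set.uIcc_of_le hFt] at hle
  have hd : ∫ u in (0 : ℝ)..t, deriv F u = 2 * ∫ u in (0 : ℝ)..t, L u * F u := by
    rw [← intervalIntegral.integral_const_mul]
    refine intervalIntegral.integral_congr_ae ?_
    filter_upwards [(hL t ht).ae_hasDerivAt_integral] with u hu hu'
    have := (((hu (Set.uIoc_subset_uIcc hu') 0 Set.left_mem_uIcc).const_mul 2).exp).deriv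
    simp only [hF]
    rw [this]
    ring
  have h1 := hle.2
  rw [hd, h0] at h1
  change ∫ u in (0 : ℝ)..t, L u * F u ≤ 1 / 2 * F t
  linarith

/-- Global solvability of `x' = f(t, x)` in integrated form, for a bounded and globally Lipschitz
right-hand side whose bounds are locally integrable in time. -/
theorem exists_integral_solution [CompleteSpace E] {f : ℝ → E → E} {L : ℝ → ℝ}
    (hL : ∀ t, 0 ≤ t → IntervalIntegrable L volume 0 t)
    (hb : ∀ t, 0 ≤ t → ∀ x, ‖f t x‖ ≤ L t)
    (hlip : ∀ t, 0 ≤ t → ∀ x y, ‖f t x - f t y‖ ≤ L t * ‖x - y‖)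
    (hm : ∀ x : ℝ → E, ContinuousOn x (Set.Ici 0) →
      ∀ t, 0 ≤ t → IntervalIntegrable (fun u => f u (x u)) volume 0 t) (x₀ : E) :
    ∃ x : ℝ → E, x 0 = x₀ ∧ IsPrimitive x (fun u => f u (x u)) := by
  have hL0 : ∀ t, 0 ≤ t → 0 ≤ L t := fun t ht => (norm_nonneg _).trans (hb t ht 0)
  set Λ : ℝ → ℝ := fun t => ∫ u in (0 : ℝ)..t, L u with hΛ
  have hΛp : IsPrimitive Λ L := ⟨hL, fun t _ => by simp [hΛ]⟩
  have hΛ0 : ∀ t, 0 ≤ t → 0 ≤ Λ t := fun t ht =>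
    intervalIntegral.integral_nonneg ht fun u hu => hL0 u hu.1
  have hexp : ∀ c : ℝ, ContinuousOn (fun t => Real.exp (c * Λ t)) (Set.Ici 0) := fun c =>
    (hΛp.continuousOn.const_mul c).rexp
  -- Bielecki's weighted norm: a path is written e^{2Λ} times a bounded continuous function, which
  -- makes the Picard map a contraction on all of [0, ∞) at once.
  set X : (ℝ≥0 →ᵇ E) → ℝ → E := fun v t => Real.exp (2 * Λ t) • v t.toNNReal with hX
  have hXc : ∀ v, ContinuousOn (X v) (Set.Ici 0) := fun v =>
    (hexp 2).smul ((v.continuous.comp continuous_real_toNNReal).continuousOn)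
  have hp : ∀ v, IsPrimitive (fun t => x₀ + ∫ u in (0 : ℝ)..t, f u (X v u))
      (fun u => f u (X v u)) := fun v =>
    ⟨hm _ (hXc v), fun t ht => by simp⟩
  have hbound : ∀ v t, 0 ≤ t →
      ‖Real.exp (-2 * Λ t) • (x₀ + ∫ u in (0 : ℝ)..t, f u (X v u))‖ ≤ ‖x₀‖ + 1 := by
    intro v t ht
    have h1 : ‖∫ u in (0 : ℝ)..t, f u (X v u)‖ ≤ Λ t :=
      intervalIntegral.norm_integral_le_of_norm_le ht
        (ae_of_all _ fun u hu => hb u hu.1.le _) (hL t ht)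
    rw [norm_smul, Real.norm_of_nonneg (Real.exp_nonneg _)]
    have h2 : ‖x₀ + ∫ u in (0 : ℝ)..t, f u (X v u)‖ ≤ ‖x₀‖ + Λ t :=
      (norm_add_le _ _).trans (by linarith)
    have h3 : Real.exp (-2 * Λ t) ≤ 1 := Real.exp_le_one_iff.2 (by linarith [hΛ0 t ht])
    have h4 : Real.exp (-2 * Λ t) * Λ t ≤ 1 := by
      have h5 : Λ t ≤ Real.exp (2 * Λ t) := by
        linarith [Real.add_one_le_exp (2 * Λ t), hΛ0 t ht]
      calc Real.exp (-2 * Λ t) * Λ t ≤ Real.exp (-2 * Λ t) * Real.exp (2 * Λ t) :=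
            mul_le_mul_of_nonneg_left h5 (Real.exp_nonneg _)
        _ = 1 := by rw [← Real.exp_add]; simp
    calc Real.exp (-2 * Λ t) * ‖x₀ + ∫ u in (0 : ℝ)..t, f u (X v u)‖
        ≤ Real.exp (-2 * Λ t) * (‖x₀‖ + Λ t) := mul_le_mul_of_nonneg_left h2 (Real.exp_nonneg _)
      _ = Real.exp (-2 * Λ t) * ‖x₀‖ + Real.exp (-2 * Λ t) * Λ t := mul_add _ _ _
      _ ≤ 1 * ‖x₀‖ + 1 := add_le_add (mul_le_mul_of_nonneg_right h3 (norm_nonneg _)) h4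
      _ = ‖x₀‖ + 1 := by rw [one_mul]
  set Φ : (ℝ≥0 →ᵇ E) → (ℝ≥0 →ᵇ E) := fun v =>
    BoundedContinuousFunction.ofNormedAddCommGroup
      (fun t : ℝ≥0 => Real.exp (-2 * Λ t) • (x₀ + ∫ u in (0 : ℝ)..t, f u (X v u)))
      (((hexp (-2)).smul (hp v).continuousOn).comp_continuous NNReal.continuous_coe fun t => t.2)
      (‖x₀‖ + 1) (fun t => hbound v t t.2) with hΦ
  -- The weight turns the Lipschitz estimate into e^{-2Λ(t)} ∫ L e^{2Λ} ≤ 1/2.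
  have hcontr : ContractingWith (1 / 2) Φ := by
    refine ⟨by norm_num, LipschitzWith.of_dist_le_mul fun v w => ?_⟩
    refine (BoundedContinuousFunction.dist_le (by positivity)).2 fun t => ?_
    have ht : (0 : ℝ) ≤ t := t.2
    have hE : IntervalIntegrable (fun u => L u * Real.exp (2 * Λ u)) volume 0 t :=
      (hL t ht).mul_continuousOn ((hexp 2).mono (by
        rw [Set.uIcc_of_le ht]; exact Set.Icc_subset_Ici_self))
    have h1 : ‖∫ u in (0 : ℝ)..t, (f u (X v u) - f u (X w u))‖ ≤
        ∫ u in (0 : ℝ)..t, L u * Real.exp (2 * Λ u) * dist v w := by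
      refine intervalIntegral.norm_integral_le_of_norm_le ht
        (ae_of_all _ fun u hu => ?_) (hE.mul_const _)
      refine (hlip u hu.1.le _ _).trans ?_
      rw [mul_assoc]
      refine mul_le_mul_of_nonneg_left ?_ (hL0 u hu.1.le)
      simp only [hX]
      rw [← smul_sub, norm_smul, Real.norm_of_nonneg (Real.exp_nonneg _), ← dist_eq_norm]
      exact mul_le_mul_of_nonneg_left (BoundedContinuousFunction.dist_coe_le_dist _)
        (Real.exp_nonneg _)
    have h2 : Φ v t - Φ w t =
        Real.exp (-2 * Λ t) • ∫ u in (0 : ℝ)..t, (f u (X v u) - f u (X w u)) := by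
      rw [intervalIntegral.integral_sub (hm _ (hXc v) t ht) (hm _ (hXc w) t ht)]
      simp only [hΦ, BoundedContinuousFunction.coe_ofNormedAddCommGroup]
      rw [← smul_sub, add_sub_add_left_eq_sub]
    rw [dist_eq_norm, h2, norm_smul, Real.norm_of_nonneg (Real.exp_nonneg _)]
    rw [intervalIntegral.integral_mul_const] at h1
    have h3 := integral_mul_exp_primitive_le hL hL0 ht
    calc Real.exp (-2 * Λ t) * ‖∫ u in (0 : ℝ)..t, (f u (X v u) - f u (X w u))‖
        ≤ Real.exp (-2 * Λ t) * (1 / 2 * Real.exp (2 * Λ t) * dist v w) :=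
          mul_le_mul_of_nonneg_left (h1.trans (mul_le_mul_of_nonneg_right h3 dist_nonneg))
            (Real.exp_nonneg _)
      _ = (Real.exp (-2 * Λ t) * Real.exp (2 * Λ t)) * (1 / 2 * dist v w) := by ring
      _ = ((1 / 2 : ℝ≥0) : ℝ) * dist v w := by rw [← Real.exp_add]; simp
  set v := hcontr.fixedPoint
  have hv : Φ v = v := hcontr.fixedPoint_isFixedPt
  have hXv : ∀ t, 0 ≤ t → X v t = x₀ + ∫ u in (0 : ℝ)..t, f u (X v u) := by
    intro t ht
    have : v t.toNNReal = Real.exp (-2 * Λ t) • (x₀ + ∫ u in (0 : ℝ)..t, f u (X v u)) := by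
      conv_lhs => rw [← hv]
      simp only [hΦ, BoundedContinuousFunction.coe_ofNormedAddCommGroup, Real.coe_toNNReal t ht]
    simp only [hX] at this ⊢
    rw [this, smul_smul, ← Real.exp_add]
    simp
  have h0 : X v 0 = x₀ := by simpa using hXv 0 le_rfl
  exact ⟨X v, h0, hm _ (hXc v), fun t ht => by rw [h0]; exact hXv t ht⟩

end Caratheodory

/-- Gronwall for a finite family in which each rate is controlled by the largest member at the same
instant; the scalar inequality is applied to the sup norm, so the size of the family does not enter.
-/
theorem le_mul_exp_of_primitive_le {ι : Type*} [Fintype ι] {D D' : ι → ℝ → ℝ} {K δ : ℝ}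
    (hK : 0 ≤ K) (hδ : 0 ≤ δ) (hD : ∀ i, IsPrimitive (D i) (D' i))
    (hD0 : ∀ i t, 0 ≤ t → 0 ≤ D i t)
    (hb : ∀ i t, 0 ≤ t → ∀ M, (∀ j, D j t ≤ M) → D' i t ≤ K * M)
    (hi : ∀ i, D i 0 ≤ δ) (i : ι) {t : ℝ} (ht : 0 ≤ t) : D i t ≤ δ * Real.exp (K * t) := by
  set B : ℝ → ℝ := fun t => ‖fun i => D i t‖ with hB
  have hBc : ContinuousOn B (Set.Ici 0) :=
    (continuousOn_pi.2 fun i => (hD i).continuousOn).norm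
  have hle : ∀ i t, D i t ≤ B t := fun i t =>
    (le_abs_self _).trans (norm_le_pi_norm (fun i => D i t) i)
  have hBi : ∀ t, 0 ≤ t → IntervalIntegrable B volume 0 t := fun t ht =>
    (hBc.mono (by rw [Set.uIcc_of_le ht]; exact Set.Icc_subset_Ici_self)).intervalIntegrable
  refine (hle i t).trans (le_mul_exp_of_le_add_integral hK hBc (fun t ht => ?_) ht)
  have hI0 : 0 ≤ ∫ u in (0 : ℝ)..t, B u :=
    intervalIntegral.integral_nonneg ht fun u _ => norm_nonneg _
  refine (pi_norm_le_iff_of_nonneg (by positivity)).2 fun i => ?_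
  rw [Real.norm_of_nonneg (hD0 i t ht), (hD i).eq_add_integral t ht,
    ← intervalIntegral.integral_const_mul]
  refine add_le_add (hi i) (intervalIntegral.integral_mono_on ht ((hD i).integrable t ht)
    ((hBi t ht).const_mul K) fun u hu => hb i u hu.1 _ fun j => hle j u)

/-- Only the row sum of the couplings enters, never the number of sites; this is the source of the
uniformity in N. -/
theorem abs_coupling_sum_le {N : ℕ} {J₀ C : ℝ} {J : Fin N → Fin 3 → Fin 3 → ℝ}
    (hJ : ∑ α, ∑ β, ∑ j, |J j α β| ≤ J₀) (hC : 0 ≤ C) {c : Fin N → Fin 3 → Fin 3 → ℝ}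
    (hc : ∀ j α β, |c j α β| ≤ C) :
    |∑ j, ∑ α, ∑ β, J j α β * c j α β| ≤ J₀ * C := by
  calc |∑ j, ∑ α, ∑ β, J j α β * c j α β|
      ≤ ∑ j, ∑ α, ∑ β, |J j α β| * C := by
        refine (Finset.abs_sum_le_sum_abs _ _).trans (Finset.sum_le_sum fun j _ => ?_)
        refine (Finset.abs_sum_le_sum_abs _ _).trans (Finset.sum_le_sum fun α _ => ?_)
        refine (Finset.abs_sum_le_sum_abs _ _).trans (Finset.sum_le_sum fun β _ => ?_)
        rw [abs_mul]
        exact mul_le_mul_of_nonneg_left (hc j α β) (abs_nonneg _)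
    _ = (∑ α, ∑ β, ∑ j, |J j α β|) * C := by
        simp only [Finset.sum_mul]
        rw [Finset.sum_comm]
        exact Finset.sum_congr rfl fun α _ => Finset.sum_comm
    _ ≤ J₀ * C := mul_le_mul_of_nonneg_right hJ hC

/-! ### The classical equations of motion -/

section Classical

variable {N : ℕ} {J₀ : ℝ} {J : ℝ → Fin N → Fin N → Fin 3 → Fin 3 → ℝ} {h : ℝ → Fin N → Fin 3 → ℝ}

theorem Admissible.nonneg (hJ : Admissible J₀ J h) (i : Fin N) : 0 ≤ J₀ :=
  (Finset.sum_nonneg fun _ _ => Finset.sum_nonneg fun _ _ => Finset.sum_nonneg fun _ _ =>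
    abs_nonneg _).trans (hJ.bound 0 le_rfl i)

theorem continuousOn_uIcc_of_Ici {f : ℝ → ℝ} (hf : ContinuousOn f (Set.Ici 0)) {t : ℝ}
    (ht : 0 ≤ t) : ContinuousOn f (Set.uIcc 0 t) :=
  hf.mono (by rw [Set.uIcc_of_le ht]; exact Set.Icc_subset_Ici_self)

theorem Admissible.effectiveField_integrable (hJ : Admissible J₀ J h) {s : ℝ → Fin N → Fin 3 → ℝ}
    (hs : ∀ i α, ContinuousOn (fun t => s t i α) (Set.Ici 0)) (i : Fin N) (α : Fin 3) {t : ℝ}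
    (ht : 0 ≤ t) :
    IntervalIntegrable (fun u => effectiveField (J u) (h u) (s u) i α) volume 0 t := by
  unfold effectiveField
  refine (hJ.integrable_field t ht i α).add ?_
  have := IntervalIntegrable.sum (μ := volume) (a := 0) (b := t) Finset.univ
    (f := fun j u => ∑ β, J u i j α β * s u j β) fun j _ => by
      have := IntervalIntegrable.sum (μ := volume) (a := 0) (b := t) Finset.univ
        (f := fun β u => J u i j α β * s u j β) fun β _ =>
          (hJ.integrable_coupling t ht i j α β).mul_continuousOn
            (continuousOn_uIcc_of_Ici (hs j β) ht)
      simpa only [Finset.sum_fn] using this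
  simpa only [Finset.sum_fn] using this

theorem Admissible.torque_integrable (hJ : Admissible J₀ J h) {s : ℝ → Fin N → Fin 3 → ℝ}
    (hs : ∀ i α, ContinuousOn (fun t => s t i α) (Set.Ici 0)) (i : Fin N) (α : Fin 3) {t : ℝ}
    (ht : 0 ≤ t) :
    IntervalIntegrable (fun u => torque (J u) (h u) (s u) i α) volume 0 t := by
  have key : ∀ β γ, IntervalIntegrable
      (fun u => s u i β * effectiveField (J u) (h u) (s u) i γ) volume 0 t := fun β γ =>
    (hJ.effectiveField_integrable hs i γ ht).continuousOn_mul (continuousOn_uIcc_of_Ici (hs i β) ht)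
  simp only [torque, cross_apply]
  fin_cases α
  · exact (key 1 2).sub (key 2 1)
  · exact (key 2 0).sub (key 0 2)
  · exact (key 0 1).sub (key 1 0)

theorem IsClassicalTrajectory.continuousOn_apply {s : ℝ → Fin N → Fin 3 → ℝ}
    (hs : IsClassicalTrajectory J h s) (i : Fin N) (α : Fin 3) :
    ContinuousOn (fun t => s t i α) (Set.Ici 0) :=
  continuousOn_pi.1 (continuousOn_pi.1 hs.1 i) α

theorem IsClassicalTrajectory.isPrimitive (hJ : Admissible J₀ J h) {s : ℝ → Fin N → Fin 3 → ℝ}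
    (hs : IsClassicalTrajectory J h s) (i : Fin N) (α : Fin 3) :
    IsPrimitive (fun t => s t i α) (fun t => torque (J t) (h t) (s t) i α) :=
  ⟨fun _ ht => hJ.torque_integrable hs.continuousOn_apply i α ht, fun t ht => hs.2 t ht i α⟩

theorem sum_mul_cross_self (x b : Fin 3 → ℝ) : ∑ α, x α * crossProduct x b α = 0 :=
  dot_self_cross x b

/-- The derivative of |x|² is 2c x·(x × b) = 0. The scalar c serves the modified flow in the
existence proof, where x is replaced by a multiple of itself. -/
theorem sum_sq_eq_of_isPrimitive_cross {x b : ℝ → Fin 3 → ℝ} {c : ℝ → ℝ}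
    (hx : ∀ α, IsPrimitive (fun t => x t α) (fun t => crossProduct (c t • x t) (b t) α)) {t : ℝ}
    (ht : 0 ≤ t) : ∑ α, x t α ^ 2 = ∑ α, x 0 α ^ 2 := by
  have h1 : IsPrimitive (fun t => ∑ α, x t α * x t α) (fun _ => 0) := by
    refine (IsPrimitive.sum Finset.univ fun α _ => (hx α).mul_real (hx α)).congr fun t _ => ?_
    have := sum_mul_cross_self (x t) (b t)
    simp only [map_smul, LinearMap.smul_apply, Pi.smul_apply, smul_eq_mul]
    rw [← mul_zero (2 * c t), ← this, Finset.mul_sum]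
    exact Finset.sum_congr rfl fun α _ => by ring
  simpa [sq] using h1.eq_add_integral t ht

theorem IsClassicalTrajectory.sum_sq_eq (hJ : Admissible J₀ J h) {s : ℝ → Fin N → Fin 3 → ℝ}
    (hs : IsClassicalTrajectory J h s) (i : Fin N) {t : ℝ} (ht : 0 ≤ t) :
    ∑ α, s t i α ^ 2 = ∑ α, s 0 i α ^ 2 :=
  sum_sq_eq_of_isPrimitive_cross (x := fun t => s t i) (c := fun _ => 1)
    (b := fun t => effectiveField (J t) (h t) (s t) i)
    (fun α => by simpa [torque] using hs.isPrimitive hJ i α) ht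

theorem abs_le_one_of_sum_sq {x : Fin 3 → ℝ} (hx : ∑ α, x α ^ 2 = 1) (α : Fin 3) : |x α| ≤ 1 := by
  rw [← sq_le_one_iff_abs_le_one, ← hx]
  exact Finset.single_le_sum (f := fun α => x α ^ 2) (fun β _ => sq_nonneg _) (Finset.mem_univ α)

/-- The rate of change of the scalar product of the spins at site `i` along two trajectories. -/
theorem sum_torque_mul_add (J : Fin N → Fin N → Fin 3 → Fin 3 → ℝ) (h : Fin N → Fin 3 → ℝ)
    (s s' : Fin N → Fin 3 → ℝ) (i : Fin N) :
    ∑ α, (torque J h s i α * s' i α + s i α * torque J h s' i α) =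
      ∑ j, ∑ α, ∑ β, J i j α β *
        ((s j β - s' j β) * crossProduct (s' i - s i) (s i) α) := by
  have h1 : ∀ α, effectiveField J h s i α - effectiveField J h s' i α =
      ∑ j, ∑ β, J i j α β * (s j β - s' j β) := fun α => by
    simp [effectiveField, mul_sub, Finset.sum_sub_distrib]
  have h2 : ∑ j, ∑ α, ∑ β, J i j α β *
        ((s j β - s' j β) * crossProduct (s' i - s i) (s i) α) =
      ∑ α, (effectiveField J h s i α - effectiveField J h s' i α) *
        crossProduct (s' i - s i) (s i) α := by
    simp only [h1, Finset.sum_mul, mul_assoc]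
    exact Finset.sum_comm
  rw [h2]
  simp only [torque, cross_apply, Fin.sum_univ_three, Pi.sub_apply, Matrix.cons_val]
  ring

theorem abs_cross_le {x y : Fin 3 → ℝ} {a b : ℝ} (hx : ∀ α, |x α| ≤ a) (hy : ∀ α, |y α| ≤ b)
    (α : Fin 3) : |crossProduct x y α| ≤ 2 * (a * b) := by
  have ha : 0 ≤ a := (abs_nonneg _).trans (hx 0)
  have key : ∀ β γ, |x β * y γ| ≤ a * b := fun β γ => by
    rw [abs_mul]
    exact mul_le_mul (hx β) (hy γ) (abs_nonneg _) ha
  have key' : ∀ β γ, |x β * y γ - x γ * y β| ≤ 2 * (a * b) := fun β γ =>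
    (abs_sub _ _).trans (by linarith [key β γ, key γ β])
  rw [cross_apply]
  fin_cases α
  · exact key' 1 2
  · exact key' 2 0
  · exact key' 0 1

/-- For two trajectories with the same field, the derivative of |s_i - s'_i|² contains only the
difference of the effective fields: h_i drops out and Gronwall with δ = 0 applies at a rate fixed by
J₀. -/
theorem IsClassicalTrajectory.unique (hJ : Admissible J₀ J h) {s s' : ℝ → Fin N → Fin 3 → ℝ}
    (hs : IsClassicalTrajectory J h s) (hs' : IsClassicalTrajectory J h s')
    (h0 : s' 0 = s 0) (hu : ∀ i, ∑ α, s 0 i α ^ 2 = 1) {t : ℝ} (ht : 0 ≤ t) : s' t = s t := by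
  have hsq : ∀ t, 0 ≤ t → ∀ i, ∑ α, s t i α ^ 2 = 1 := fun t ht i => by
    rw [hs.sum_sq_eq hJ i ht, hu i]
  have hsq' : ∀ t, 0 ≤ t → ∀ i, ∑ α, s' t i α ^ 2 = 1 := fun t ht i => by
    rw [hs'.sum_sq_eq hJ i ht, h0, hu i]
  have hsub : ∀ i α, IsPrimitive (fun t => s' t i α - s t i α)
      (fun t => torque (J t) (h t) (s' t) i α - torque (J t) (h t) (s t) i α) := fun i α => by
    simpa [sub_eq_add_neg] using
      (hs'.isPrimitive hJ i α).add ((hs.isPrimitive hJ i α).const_mul_real (-1))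
  have hD : ∀ i, IsPrimitive (fun t => ∑ α, (s' t i α - s t i α) * (s' t i α - s t i α))
      (fun t => -2 * ∑ j, ∑ α, ∑ β, J t i j α β *
        ((s t j β - s' t j β) * crossProduct (s' t i - s t i) (s t i) α)) := fun i => by
    refine (IsPrimitive.sum Finset.univ fun α _ => (hsub i α).mul_real (hsub i α)).congr
      fun t ht => ?_
    rw [← sum_torque_mul_add (J t) (h t)]
    have e1 := sum_mul_cross_self (s t i) (effectiveField (J t) (h t) (s t) i)
    have e2 := sum_mul_cross_self (s' t i) (effectiveField (J t) (h t) (s' t) i)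
    simp only [Fin.sum_univ_three, torque] at e1 e2 ⊢
    linear_combination 2 * e1 + 2 * e2
  -- The absolute value is needed because J₀ may be negative when there are no sites.
  have hb := le_mul_exp_of_primitive_le (K := 4 * |J₀|) (δ := 0) (by positivity) le_rfl hD
    (fun i t _ => Finset.sum_nonneg fun α _ => mul_self_nonneg _) (fun i t ht M hM => ?_)
    (fun i => by simp [h0])
  · funext i α
    have h1 := hb i ht
    rw [zero_mul] at h1
    have h2 := Finset.single_le_sum
      (f := fun α => (s' t i α - s t i α) * (s' t i α - s t i α))
      (fun β _ => mul_self_nonneg _) (Finset.mem_univ α)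
    exact sub_eq_zero.1 (mul_self_eq_zero.1 (le_antisymm (h2.trans h1) (mul_self_nonneg _)))
  · have hM0 : 0 ≤ M := (Finset.sum_nonneg fun α _ => mul_self_nonneg _).trans (hM i)
    have hd : ∀ j α, |s' t j α - s t j α| ≤ Real.sqrt M := fun j α =>
      Real.abs_le_sqrt (by
        rw [sq]
        exact (Finset.single_le_sum
          (f := fun α => (s' t j α - s t j α) * (s' t j α - s t j α))
          (fun β _ => mul_self_nonneg _) (Finset.mem_univ α)).trans (hM j))
    have h1 := abs_coupling_sum_le (hJ.bound t ht i) (C := 2 * M) (by positivity)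
      (c := fun j α β => (s t j β - s' t j β) * crossProduct (s' t i - s t i) (s t i) α)
      fun j α β => by
        have h2 := abs_cross_le (x := s' t i - s t i) (y := s t i) (hd i)
          (abs_le_one_of_sum_sq (hsq t ht i)) α
        rw [abs_mul, abs_sub_comm]
        refine (mul_le_mul (hd j β) h2 (abs_nonneg _) (Real.sqrt_nonneg _)).trans_eq ?_
        linear_combination 2 * Real.mul_self_sqrt hM0
    have h2 := (abs_le.1 h1).1
    rw [abs_of_nonneg (hJ.nonneg i)]
    linarith

theorem IsClassicalTrajectory.hasDerivWithinAt (hJ : Admissible J₀ J h)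
    {s : ℝ → Fin N → Fin 3 → ℝ} (hs : IsClassicalTrajectory J h s) {t : ℝ} (ht : 0 ≤ t)
    (hJt : ∀ i j α β, ContinuousWithinAt (fun u => J u i j α β) (Set.Ici 0) t)
    (hht : ∀ i α, ContinuousWithinAt (fun u => h u i α) (Set.Ici 0) t) (i : Fin N) :
    HasDerivWithinAt (fun u => s u i) (torque (J t) (h t) (s t) i) (Set.Ici 0) t := by
  have hst : ∀ i α, ContinuousWithinAt (fun u => s u i α) (Set.Ici 0) t := fun i α =>
    hs.continuousOn_apply i α t ht
  have hfield : ∀ i α, ContinuousWithinAt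
      (fun u => effectiveField (J u) (h u) (s u) i α) (Set.Ici 0) t := fun i α =>
    (hht i α).add (tendsto_finsetSum _ fun j _ => tendsto_finsetSum _ fun β _ =>
      (hJt i j α β).mul (hst j β))
  have key : ∀ β γ, ContinuousWithinAt
      (fun u => s u i β * effectiveField (J u) (h u) (s u) i γ) (Set.Ici 0) t := fun β γ =>
    (hst i β).mul (hfield i γ)
  refine hasDerivWithinAt_pi.2 fun α => ?_
  have hcont : ContinuousWithinAt (fun u => torque (J u) (h u) (s u) i α) (Set.Ici 0) t := by
    simp only [torque, cross_apply]
    fin_cases α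
    · exact (key 1 2).sub (key 2 1)
    · exact (key 2 0).sub (key 0 2)
    · exact (key 0 1).sub (key 1 0)
  have hp := hs.isPrimitive hJ i α
  have hd : HasDerivWithinAt (fun t => ∫ u in (0 : ℝ)..t, torque (J u) (h u) (s u) i α)
      (torque (J t) (h t) (s t) i α) (Set.Ici 0) t := by
    rcases ht.eq_or_lt with rfl | hpos
    · refine intervalIntegral.integral_hasDerivWithinAt_right (hp.integrable 0 le_rfl) ?_
        (hcont.mono Set.Ioi_subset_Ici_self)
      exact ⟨Set.Ioc 0 1, Ioc_mem_nhdsGT one_pos, (hp.integrable 1 zero_le_one).1.1⟩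
    · have hmem : Set.Ici (0 : ℝ) ∈ 𝓝 t := Ici_mem_nhds hpos
      refine (intervalIntegral.integral_hasDerivAt_right (hp.integrable t ht) ?_
        (hcont.continuousAt hmem)).hasDerivWithinAt
      exact ⟨Set.Ioc 0 (t + 1), Ioc_mem_nhds hpos (lt_add_one t),
        (hp.integrable (t + 1) (by linarith)).1.1⟩
  exact (hd.const_add (s 0 i α)).congr (fun u hu => hs.2 u hu i α) (hs.2 t ht i α)

/-- A Lipschitz map of `ℝ³` into the unit ball which fixes the unit sphere. -/
def retract (x : Fin 3 → ℝ) : Fin 3 → ℝ := (2 / (1 + ∑ α, x α ^ 2)) • x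

theorem abs_retract_le (x : Fin 3 → ℝ) (α : Fin 3) : |retract x α| ≤ 1 := by
  have h1 : x α ^ 2 ≤ ∑ α, x α ^ 2 :=
    Finset.single_le_sum (f := fun α => x α ^ 2) (fun β _ => sq_nonneg _) (Finset.mem_univ α)
  have h2 : 0 < 1 + ∑ α, x α ^ 2 := by positivity
  simp only [retract, Pi.smul_apply, smul_eq_mul]
  rw [div_mul_eq_mul_div, abs_div, abs_of_pos h2, div_le_one h2, abs_mul, abs_two]
  nlinarith [sq_nonneg (|x α| - 1), sq_abs (x α)]

/-- Over the common denominator P the numerator is at most 2(1 + 3·2)P‖x - y‖; the resulting 14 is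
rounded up to 16. -/
theorem abs_retract_sub_le (x y : Fin 3 → ℝ) (α : Fin 3) :
    |retract x α - retract y α| ≤ 16 * ‖x - y‖ := by
  set d := ‖x - y‖ with hd
  have hd0 : 0 ≤ d := norm_nonneg _
  have hxy : ∀ β, |x β - y β| ≤ d := fun β => norm_le_pi_norm (x - y) β
  set X := ∑ β, x β ^ 2 with hX
  set Y := ∑ β, y β ^ 2 with hY
  have hX0 : 0 ≤ X := Finset.sum_nonneg fun _ _ => sq_nonneg _
  have hY0 : 0 ≤ Y := Finset.sum_nonneg fun _ _ => sq_nonneg _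
  have hxX : ∀ β, x β ^ 2 ≤ X := fun β =>
    Finset.single_le_sum (f := fun β => x β ^ 2) (fun β _ => sq_nonneg _) (Finset.mem_univ β)
  have hyY : ∀ β, y β ^ 2 ≤ Y := fun β =>
    Finset.single_le_sum (f := fun β => y β ^ 2) (fun β _ => sq_nonneg _) (Finset.mem_univ β)
  set P := (1 + X) * (1 + Y) with hP
  have hP0 : 0 < P := by positivity
  have e : retract x α - retract y α =
      2 * ((x α - y α) * (1 + Y) + y α * ∑ β, (y β - x β) * (y β + x β)) / P := by
    have e1 : ∑ β, (y β - x β) * (y β + x β) = Y - X := by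
      rw [hX, hY, ← Finset.sum_sub_distrib]
      exact Finset.sum_congr rfl fun β _ => by ring
    have hX1 : 1 + X ≠ 0 := by positivity
    have hY1 : 1 + Y ≠ 0 := by positivity
    rw [e1]
    simp only [retract, Pi.smul_apply, smul_eq_mul, ← hX, ← hY, hP]
    field_simp
    ring
  have b1 : |(x α - y α) * (1 + Y)| ≤ d * P := by
    rw [abs_mul, abs_of_nonneg (by positivity : 0 ≤ 1 + Y)]
    refine mul_le_mul (hxy α) ?_ (by positivity) hd0
    nlinarith [mul_nonneg hX0 hY0]
  have b2 : ∀ β, |y α * ((y β - x β) * (y β + x β))| ≤ d * (2 * P) := fun β => by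
    have c1 : |y α| * |y β| ≤ P := by
      have := hyY α
      have := hyY β
      nlinarith [sq_abs (y α), sq_abs (y β), sq_nonneg (|y α| - |y β|), mul_nonneg hX0 hY0]
    have c2 : |y α| * |x β| ≤ P := by
      have := hyY α
      have := hxX β
      nlinarith [sq_abs (y α), sq_abs (x β), sq_nonneg (|y α| - |x β|), mul_nonneg hX0 hY0]
    rw [abs_mul, abs_mul, mul_left_comm]
    refine mul_le_mul (by rw [abs_sub_comm]; exact hxy β) ?_ (by positivity) hd0
    have := abs_add_le (y β) (x β)
    nlinarith [abs_nonneg (y α)]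
  have b3 : |y α * ∑ β, (y β - x β) * (y β + x β)| ≤ 3 * (d * (2 * P)) := by
    rw [Finset.mul_sum]
    refine (Finset.abs_sum_le_sum_abs _ _).trans ((Finset.sum_le_sum fun β _ => b2 β).trans_eq ?_)
    simp
  rw [e, abs_div, abs_of_pos hP0, div_le_iff₀ hP0, abs_mul, abs_two]
  have := abs_add_le ((x α - y α) * (1 + Y)) (y α * ∑ β, (y β - x β) * (y β + x β))
  nlinarith [mul_nonneg hd0 hP0.le]

theorem retract_eq_self {x : Fin 3 → ℝ} (hx : ∑ α, x α ^ 2 = 1) : retract x = x := by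
  rw [retract, hx]
  norm_num

theorem continuous_retract : Continuous retract := by
  have h : Continuous fun x : Fin 3 → ℝ => 2 / (1 + ∑ α, x α ^ 2) :=
    Continuous.div continuous_const (by fun_prop) fun x => by positivity
  exact h.smul continuous_id

theorem abs_effectiveField_sub_le {J : Fin N → Fin N → Fin 3 → Fin 3 → ℝ} {h : Fin N → Fin 3 → ℝ}
    {p q : Fin N → Fin 3 → ℝ} {d : ℝ} (hpq : ∀ j β, |p j β - q j β| ≤ d) (i : Fin N) (α : Fin 3) :
    |effectiveField J h p i α - effectiveField J h q i α| ≤ (∑ j, ∑ β, |J i j α β|) * d := by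
  simp only [effectiveField, add_sub_add_left_eq_sub, ← Finset.sum_sub_distrib, Finset.sum_mul,
    ← mul_sub]
  refine (Finset.abs_sum_le_sum_abs _ _).trans (Finset.sum_le_sum fun j _ => ?_)
  refine (Finset.abs_sum_le_sum_abs _ _).trans (Finset.sum_le_sum fun β _ => ?_)
  rw [abs_mul]
  exact mul_le_mul_of_nonneg_left (hpq j β) (abs_nonneg _)

/-- The torque is quadratic in s, so it is evaluated at the retracted spins, where it is bounded and
Lipschitz. The modified flow still rotates each spin about an axis and preserves its length; hence
the solution stays on the unit spheres, where the retraction is the identity. -/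
theorem exists_isClassicalTrajectory (hJ : Admissible J₀ J h) {s₀ : Fin N → Fin 3 → ℝ}
    (hs₀ : ∀ i, ∑ α, s₀ i α ^ 2 = 1) : ∃ s, s 0 = s₀ ∧ IsClassicalTrajectory J h s := by
  set f : ℝ → (Fin N → Fin 3 → ℝ) → (Fin N → Fin 3 → ℝ) := fun t x =>
    torque (J t) (h t) fun i => retract (x i) with hf
  set B : ℝ → ℝ := fun t => ∑ i, ∑ α, (|h t i α| + ∑ j, ∑ β, |J t i j α β|) with hB
  have hB0 : ∀ t, 0 ≤ B t := fun t => by positivity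
  have hfield : ∀ t i α, |h t i α| + ∑ j, ∑ β, |J t i j α β| ≤ B t := fun t i α =>
    (Finset.single_le_sum (f := fun α => |h t i α| + ∑ j, ∑ β, |J t i j α β|)
      (fun α _ => by positivity) (Finset.mem_univ α)).trans
    (Finset.single_le_sum (f := fun i => ∑ α, (|h t i α| + ∑ j, ∑ β, |J t i j α β|))
      (fun α _ => by positivity) (Finset.mem_univ i))
  have hBint : ∀ t, 0 ≤ t → IntervalIntegrable B volume 0 t := fun t ht => by
    have e : B = ∑ i, ∑ α, ((fun t => |h t i α|) + ∑ j, ∑ β, fun t => |J t i j α β|) := by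
      funext t
      simp [hB, Finset.sum_apply]
    rw [e]
    exact IntervalIntegrable.sum _ fun i _ => IntervalIntegrable.sum _ fun α _ =>
      (hJ.integrable_field t ht i α).abs.add (IntervalIntegrable.sum _ fun j _ =>
        IntervalIntegrable.sum _ fun β _ => (hJ.integrable_coupling t ht i j α β).abs)
  have heff : ∀ t (p : Fin N → Fin 3 → ℝ), (∀ j β, |p j β| ≤ 1) → ∀ i α,
      |effectiveField (J t) (h t) p i α| ≤ B t := fun t p hp i α => by
    have h1 := abs_effectiveField_sub_le (J := J t) (h := h t) (q := 0) (d := 1)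
      (fun j β => by simpa using hp j β) i α
    have h2 : effectiveField (J t) (h t) 0 i α = h t i α := by simp [effectiveField]
    rw [h2, mul_one] at h1
    have h3 := abs_sub_abs_le_abs_sub (effectiveField (J t) (h t) p i α) (h t i α)
    linarith [hfield t i α]
  have hret : ∀ (x : Fin N → Fin 3 → ℝ) j β, |retract (x j) β| ≤ 1 := fun x j β =>
    abs_retract_le _ _
  -- The torque is bounded by 2B. Splitting its difference into a change of spin and a change of
  -- field gives two terms, each at most 2·16·B‖x - y‖, hence 64.
  obtain ⟨s, hs0, hs⟩ := exists_integral_solution (f := f) (L := fun t => 64 * B t)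
    (fun t ht => (hBint t ht).const_mul 64)
    (fun t _ x => by
      have := hB0 t
      refine (pi_norm_le_iff_of_nonneg (by positivity)).2 fun i =>
        (pi_norm_le_iff_of_nonneg (by positivity)).2 fun α => ?_
      refine (abs_cross_le (hret x i) (heff t _ (hret x) i) α).trans (by linarith))
    (fun t _ x y => by
      have hBt := hB0 t
      refine (pi_norm_le_iff_of_nonneg (by positivity)).2 fun i =>
        (pi_norm_le_iff_of_nonneg (by positivity)).2 fun α => ?_
      have hd : ∀ j β, |retract (x j) β - retract (y j) β| ≤ 16 * ‖x - y‖ := fun j β =>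
        (abs_retract_sub_le _ _ _).trans
          (mul_le_mul_of_nonneg_left (norm_le_pi_norm (x - y) j) (by norm_num))
      have hd' : ∀ α, |(effectiveField (J t) (h t) (fun j => retract (x j)) i -
          effectiveField (J t) (h t) (fun j => retract (y j)) i) α| ≤ B t * (16 * ‖x - y‖) :=
        fun α => (abs_effectiveField_sub_le hd i α).trans (mul_le_mul_of_nonneg_right
          (by linarith [hfield t i α, abs_nonneg (h t i α)]) (by positivity))
      have e : f t x i α - f t y i α =
          crossProduct (retract (x i) - retract (y i))
            (effectiveField (J t) (h t) (fun j => retract (x j)) i) α +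
          crossProduct (retract (y i)) (effectiveField (J t) (h t) (fun j => retract (x j)) i -
            effectiveField (J t) (h t) (fun j => retract (y j)) i) α := by
        simp only [hf, torque, map_sub, LinearMap.sub_apply, Pi.sub_apply]
        ring
      have b1 := abs_cross_le (x := retract (x i) - retract (y i)) (hd i)
        (heff t _ (hret x) i) α
      have b2 := abs_cross_le (hret y i) hd' α
      rw [Pi.sub_apply, Pi.sub_apply, Real.norm_eq_abs, e]
      refine (abs_add_le _ _).trans ((add_le_add b1 b2).trans_eq (by ring)))
    (fun x hx t ht => by
      have hxc : ∀ i α, ContinuousOn (fun t => retract (x t i) α) (Set.Ici 0) := fun i α =>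
        (continuous_apply α).comp_continuousOn
          (continuous_retract.comp_continuousOn (continuousOn_pi.1 hx i))
      have := fun i α => hJ.torque_integrable hxc i α ht
      simp only [intervalIntegrable_iff] at this ⊢
      exact Integrable.of_eval fun i => Integrable.of_eval fun α => this i α) s₀
  have hcoord : ∀ i α, IsPrimitive (fun t => s t i α) (fun t => f t (s t) i α) := fun i α =>
    hs.clm_comp ((ContinuousLinearMap.proj (R := ℝ) α : (Fin 3 → ℝ) →L[ℝ] ℝ) ∘L
      (ContinuousLinearMap.proj (R := ℝ) i : (Fin N → Fin 3 → ℝ) →L[ℝ] (Fin 3 → ℝ)))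
  have hunit : ∀ t, 0 ≤ t → ∀ i, ∑ α, s t i α ^ 2 = 1 := fun t ht i => by
    rw [← hs₀ i, ← hs0]
    exact sum_sq_eq_of_isPrimitive_cross (x := fun t => s t i)
      (c := fun t => 2 / (1 + ∑ α, s t i α ^ 2))
      (b := fun t => effectiveField (J t) (h t) (fun j => retract (s t j)) i) (hcoord i) ht
  refine ⟨s, hs0, hs.continuousOn, fun t ht i α => ?_⟩
  refine ((hcoord i α).congr fun u hu => ?_).eq_add_integral t ht
  simp only [hf]
  congr
  funext j
  exact retract_eq_self (hunit u hu j)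

end Classical

/-! ### Spin matrices of one site -/

section OneSite

/-- Row k has its only possible nonzero entry at k + 1. For k = m there is none, in agreement with
the vanishing factor m - k. -/
theorem raiseMatrix_mul_conjTranspose (m : ℕ) :
    raiseMatrix m * (raiseMatrix m)ᴴ =
      Matrix.diagonal fun k : Fin (m + 1) => (((k : ℕ) + 1) * ((m : ℂ) - (k : ℕ))) := by
  ext k l
  simp only [Matrix.mul_apply, Matrix.conjTranspose_apply, raiseMatrix, Matrix.diagonal_apply]
  by_cases hk : (k : ℕ) + 1 < m + 1
  · rw [Finset.sum_eq_single (⟨k + 1, hk⟩ : Fin (m + 1))]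
    · by_cases hkl : k = l
      · subst hkl
        have h0 : (0 : ℝ) ≤ ((k : ℕ) + 1 : ℕ) * ((m : ℝ) + 1 - ((k : ℕ) + 1 : ℕ)) := by
          have : ((k : ℕ) : ℝ) + 1 ≤ m := by exact_mod_cast Nat.lt_succ_iff.1 hk
          push_cast
          exact mul_nonneg (by positivity) (by linarith)
        simp only [if_true, RCLike.star_def, Complex.conj_ofReal]
        rw [← Complex.ofReal_mul, Real.mul_self_sqrt h0]
        push_cast
        ring
      · have h : (l : ℕ) ≠ (k : ℕ) := fun h => hkl (Fin.ext h.symm)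
        simp [h, hkl]
    · intro j _ hj
      have h : (k : ℕ) + 1 ≠ (j : ℕ) := fun h => hj (Fin.ext h.symm)
      simp [h]
    · simp
  · have hkm : (k : ℕ) = m := by have := k.2; omega
    rw [Finset.sum_eq_zero]
    · simp [hkm]
    · intro j _
      have h : (k : ℕ) + 1 ≠ (j : ℕ) := by have := j.2; omega
      simp [h]

theorem conjTranspose_mul_raiseMatrix (m : ℕ) :
    (raiseMatrix m)ᴴ * raiseMatrix m =
      Matrix.diagonal fun k : Fin (m + 1) => ((k : ℕ) * ((m : ℂ) + 1 - (k : ℕ))) := by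
  ext k l
  simp only [Matrix.mul_apply, Matrix.conjTranspose_apply, raiseMatrix, Matrix.diagonal_apply]
  by_cases hk : (k : ℕ) = 0
  · rw [Finset.sum_eq_zero]
    · simp [hk]
    · intro j _
      simp [hk]
  · obtain ⟨p, hp⟩ := Nat.exists_eq_succ_of_ne_zero hk
    have hpm : p < m + 1 := by have := k.2; omega
    rw [Finset.sum_eq_single (⟨p, hpm⟩ : Fin (m + 1))]
    · by_cases hkl : k = l
      · subst hkl
        have h0 : (0 : ℝ) ≤ (k : ℕ) * ((m : ℝ) + 1 - (k : ℕ)) := by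
          have : ((k : ℕ) : ℝ) ≤ m + 1 := by exact_mod_cast k.2.le
          exact mul_nonneg (by positivity) (by linarith)
        have h1 : p + 1 = (k : ℕ) := hp.symm
        simp only [h1, if_true, RCLike.star_def, Complex.conj_ofReal]
        rw [← Complex.ofReal_mul, Real.mul_self_sqrt h0]
        push_cast
        ring
      · have h : p + 1 ≠ (l : ℕ) := fun h => hkl (Fin.ext (by omega))
        simp [h, hkl]
    · intro j _ hj
      have h : (j : ℕ) + 1 ≠ (k : ℕ) := fun h => hj (Fin.ext (by simp; omega))
      simp [h]
    · simp

/-- The commutator `[S^z, S^+] = S^+`. -/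
theorem diagonal_commutator_raiseMatrix (m : ℕ) :
    spinMatrix m 2 * raiseMatrix m - raiseMatrix m * spinMatrix m 2 = raiseMatrix m := by
  ext k l
  simp only [spinMatrix, Matrix.cons_val, Matrix.sub_apply, Matrix.diagonal_mul,
    Matrix.mul_diagonal]
  by_cases h : (k : ℕ) + 1 = (l : ℕ)
  · rw [← h]
    push_cast
    ring
  · simp [raiseMatrix, h]

theorem spinMatrix_conjTranspose (m : ℕ) (α : Fin 3) : (spinMatrix m α)ᴴ = spinMatrix m α := by
  fin_cases α
  · simp [spinMatrix, Matrix.conjTranspose_smul, add_comm]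
  · simp [spinMatrix, Matrix.conjTranspose_smul, Matrix.conjTranspose_sub]
    rw [← neg_sub (raiseMatrix m), smul_neg]
  · simp only [spinMatrix, Fin.reduceFinMk, Matrix.cons_val, Matrix.diagonal_conjTranspose]
    congr
    funext k
    simp

theorem spinMatrix_two_conjTranspose (m : ℕ) : (spinMatrix m 2)ᴴ = spinMatrix m 2 :=
  spinMatrix_conjTranspose m 2

/-- Reduces to [S^+, S^-] = 2 S^z, the difference of the two diagonal products of ladder matrices.
-/
theorem spinMatrix_commutator_zero_one (m : ℕ) :
    spinMatrix m 0 * spinMatrix m 1 - spinMatrix m 1 * spinMatrix m 0 =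
      Complex.I • spinMatrix m 2 := by
  have h : raiseMatrix m * (raiseMatrix m)ᴴ - (raiseMatrix m)ᴴ * raiseMatrix m =
      (2 : ℂ) • spinMatrix m 2 := by
    rw [raiseMatrix_mul_conjTranspose, conjTranspose_mul_raiseMatrix, Matrix.diagonal_sub]
    simp only [spinMatrix, Matrix.cons_val, ← Matrix.diagonal_smul]
    congr
    funext k
    simp [spinVal]
    ring
  have h0 : spinMatrix m 0 = (1 / 2 : ℂ) • (raiseMatrix m + (raiseMatrix m)ᴴ) := rfl
  have h1 : spinMatrix m 1 = (1 / (2 * Complex.I) : ℂ) • (raiseMatrix m - (raiseMatrix m)ᴴ) := rfl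
  have h2 : spinMatrix m 2 = (1 / 2 : ℂ) • (raiseMatrix m * (raiseMatrix m)ᴴ -
      (raiseMatrix m)ᴴ * raiseMatrix m) := by
    rw [h, smul_smul]; norm_num
  have hI : (1 / (2 * Complex.I) : ℂ) = -(Complex.I / 2) := by
    field_simp
    simp
  rw [h2, h0, h1, hI]
  simp only [smul_mul_smul_comm, add_mul, mul_add, sub_mul, mul_sub, smul_add, smul_sub, smul_smul]
  module

theorem spinMatrix_commutator_two (m : ℕ) :
    (spinMatrix m 2 * spinMatrix m 0 - spinMatrix m 0 * spinMatrix m 2 =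
      Complex.I • spinMatrix m 1) ∧
    (spinMatrix m 1 * spinMatrix m 2 - spinMatrix m 2 * spinMatrix m 1 =
      Complex.I • spinMatrix m 0) := by
  have hR := diagonal_commutator_raiseMatrix m
  have hR' := congrArg Matrix.conjTranspose hR
  rw [Matrix.conjTranspose_sub, Matrix.conjTranspose_mul, Matrix.conjTranspose_mul,
    spinMatrix_two_conjTranspose] at hR'
  have h0 : spinMatrix m 0 = (1 / 2 : ℂ) • (raiseMatrix m + (raiseMatrix m)ᴴ) := rfl
  have h1 : spinMatrix m 1 = (1 / (2 * Complex.I) : ℂ) • (raiseMatrix m - (raiseMatrix m)ᴴ) := rfl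
  have hI : (1 / (2 * Complex.I) : ℂ) = -(Complex.I / 2) := by
    field_simp
    simp
  have hI2 : Complex.I * Complex.I = -1 := Complex.I_mul_I
  have e1 : spinMatrix m 2 * raiseMatrix m = raiseMatrix m + raiseMatrix m * spinMatrix m 2 :=
    sub_eq_iff_eq_add.1 hR
  have e2 : (raiseMatrix m)ᴴ * spinMatrix m 2 =
      (raiseMatrix m)ᴴ + spinMatrix m 2 * (raiseMatrix m)ᴴ := sub_eq_iff_eq_add.1 hR'
  constructor
  · rw [h0, h1, hI]
    simp only [mul_smul_comm, smul_mul_assoc, add_mul, mul_add, e1, e2, smul_smul]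
    have : Complex.I * -(Complex.I / 2) = 1 / 2 := by linear_combination (-1 / 2) * hI2
    rw [this]
    module
  · rw [h0, h1, hI]
    simp only [mul_smul_comm, smul_mul_assoc, sub_mul, mul_sub, e1, e2, smul_smul]
    module

/-- (S^x)² + (S^y)² is half the sum of the two diagonal ladder products, and adding (S^z)² removes
the dependence on k. This Casimir identity makes the spread linear in the spin expectations. -/
theorem sum_spinMatrix_sq (m : ℕ) :
    ∑ α, spinMatrix m α * spinMatrix m α =
      ((spinVal m * (spinVal m + 1) : ℝ) : ℂ) • (1 : SiteMatrix m) := by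
  have h0 : spinMatrix m 0 = (1 / 2 : ℂ) • (raiseMatrix m + (raiseMatrix m)ᴴ) := rfl
  have h1 : spinMatrix m 1 = (1 / (2 * Complex.I) : ℂ) • (raiseMatrix m - (raiseMatrix m)ᴴ) := rfl
  have hI : (1 / (2 * Complex.I) : ℂ) = -(Complex.I / 2) := by
    field_simp
    simp
  have hI2 : -(Complex.I / 2) * -(Complex.I / 2) = (-1 / 4 : ℂ) := by
    linear_combination (1 / 4) * Complex.I_mul_I
  have h01 : spinMatrix m 0 * spinMatrix m 0 + spinMatrix m 1 * spinMatrix m 1 =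
      (1 / 2 : ℂ) • (raiseMatrix m * (raiseMatrix m)ᴴ + (raiseMatrix m)ᴴ * raiseMatrix m) := by
    rw [h0, h1, hI]
    simp only [smul_mul_smul_comm, add_mul, mul_add, sub_mul, mul_sub, hI2]
    module
  rw [Fin.sum_univ_three, h01, raiseMatrix_mul_conjTranspose, conjTranspose_mul_raiseMatrix]
  ext k l
  by_cases hkl : k = l
  · subst hkl
    simp [spinMatrix, spinVal]
    ring
  · simp [spinMatrix, hkl]

end OneSite

/-! ### Operators on the chain and their commutators -/

section Tensor

variable {N m : ℕ}

theorem tensorMatrix_mul (A B : Fin N → SiteMatrix m) :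
    tensorMatrix A * tensorMatrix B = tensorMatrix (A * B) := by
  ext k l
  simp only [Matrix.mul_apply, tensorMatrix, Pi.mul_apply, ← Finset.prod_mul_distrib]
  rw [Finset.prod_univ_sum, Fintype.piFinset_univ]

theorem tensorMatrix_one : tensorMatrix (1 : Fin N → SiteMatrix m) = 1 := by
  ext k l
  simp only [tensorMatrix, Pi.one_apply, Matrix.one_apply]
  by_cases h : k = l
  · simp [h]
  · obtain ⟨j, hj⟩ := Function.ne_iff.1 h
    rw [if_neg h]
    exact Finset.prod_eq_zero (Finset.mem_univ j) (if_neg hj)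

/-- A one-spin matrix acting at site `i`. -/
def atSite (i : Fin N) (A : SiteMatrix m) : ChainMatrix N m := tensorMatrix (Pi.mulSingle i A)

theorem siteSpin_eq_atSite (i : Fin N) (α : Fin 3) :
    siteSpin m i α = atSite i (spinMatrix m α) := rfl

/-- Isolates the single factor containing `A`, from which linearity in `A` can be read off. -/
theorem atSite_apply (i : Fin N) (A : SiteMatrix m) (k l : Fin N → Fin (m + 1)) :
    atSite i A k l = A (k i) (l i) *
      ∏ j ∈ Finset.univ.erase i, (1 : SiteMatrix m) (k j) (l j) := by
  rw [atSite, tensorMatrix, ← Finset.mul_prod_erase _ _ (Finset.mem_univ i), Pi.mulSingle_eq_same]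
  congr 1
  refine Finset.prod_congr rfl fun j hj => ?_
  rw [Pi.mulSingle_eq_of_ne (Finset.ne_of_mem_erase hj)]

theorem atSite_add (i : Fin N) (A B : SiteMatrix m) :
    atSite i (A + B) = atSite i A + atSite i B := by
  ext k l
  simp only [atSite_apply, Matrix.add_apply, add_mul]

theorem atSite_sub (i : Fin N) (A B : SiteMatrix m) :
    atSite i (A - B) = atSite i A - atSite i B := by
  ext k l
  simp only [atSite_apply, Matrix.sub_apply, sub_mul]

theorem atSite_smul (i : Fin N) (c : ℂ) (A : SiteMatrix m) :
    atSite i (c • A) = c • atSite i A := by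
  ext k l
  simp only [atSite_apply, Matrix.smul_apply, smul_eq_mul, mul_assoc]

theorem atSite_mul (i : Fin N) (A B : SiteMatrix m) :
    atSite i (A * B) = atSite i A * atSite i B := by
  rw [atSite, atSite, atSite, tensorMatrix_mul, Pi.mulSingle_mul]

theorem atSite_one (i : Fin N) : atSite i (1 : SiteMatrix m) = 1 := by
  rw [atSite, Pi.mulSingle_one, tensorMatrix_one]

theorem atSite_conjTranspose (i : Fin N) (A : SiteMatrix m) : (atSite i A)ᴴ = atSite i Aᴴ := by
  ext k l
  rw [Matrix.conjTranspose_apply, atSite_apply, atSite_apply, star_mul', star_prod,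
    Matrix.conjTranspose_apply]
  congr 1
  refine Finset.prod_congr rfl fun j _ => ?_
  simp only [Matrix.one_apply, eq_comm]
  split_ifs <;> simp

theorem siteSpin_conjTranspose (i : Fin N) (α : Fin 3) :
    (siteSpin m i α)ᴴ = siteSpin m i α := by
  rw [siteSpin_eq_atSite, atSite_conjTranspose, spinMatrix_conjTranspose]

theorem siteSpin_commute {i j : Fin N} (hij : i ≠ j) (α β : Fin 3) :
    siteSpin m i α * siteSpin m j β = siteSpin m j β * siteSpin m i α := by
  rw [siteSpin, siteSpin, tensorMatrix_mul, tensorMatrix_mul]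
  exact congrArg _ (Pi.mulSingle_commute hij _ _)

theorem sum_siteSpin_sq (i : Fin N) :
    ∑ α, siteSpin m i α * siteSpin m i α =
      ((spinVal m * (spinVal m + 1) : ℝ) : ℂ) • (1 : ChainMatrix N m) := by
  have := congrArg (atSite i) (sum_spinMatrix_sq m)
  rw [atSite_smul, atSite_one, Fin.sum_univ_three, atSite_add, atSite_add, atSite_mul, atSite_mul,
    atSite_mul] at this
  rw [← this, Fin.sum_univ_three]
  rfl

/-- The vector product `X × s` of a triple of matrices with a real vector. -/
def crossMatrix {κ : Type*} (X : Fin 3 → Matrix κ κ ℂ) (s : Fin 3 → ℝ) : Fin 3 → Matrix κ κ ℂ :=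
  ![(s 2 : ℂ) • X 1 - (s 1 : ℂ) • X 2, (s 0 : ℂ) • X 2 - (s 2 : ℂ) • X 0,
    (s 1 : ℂ) • X 0 - (s 0 : ℂ) • X 1]

/-- The spin commutation relations contracted with s: commuting with s·S_i generates precession
about s at site i and nothing elsewhere. -/
theorem siteSpin_commutator_sum (i k : Fin N) (α : Fin 3) (s : Fin 3 → ℝ) :
    Complex.I • (siteSpin m k α * (∑ γ, (s γ : ℂ) • siteSpin m i γ) -
      (∑ γ, (s γ : ℂ) • siteSpin m i γ) * siteSpin m k α) =
      if k = i then crossMatrix (siteSpin m i) s α else 0 := by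
  split_ifs with hki
  · subst hki
    have h01 := congrArg (atSite k) (spinMatrix_commutator_zero_one m)
    have h20 := congrArg (atSite k) (spinMatrix_commutator_two m).1
    have h12 := congrArg (atSite k) (spinMatrix_commutator_two m).2
    rw [atSite_sub, atSite_mul, atSite_mul, atSite_smul] at h01 h20 h12
    simp only [← siteSpin_eq_atSite] at h01 h20 h12
    simp only [sub_eq_iff_eq_add] at h01 h20 h12
    have hI2 : ∀ c : ℂ, Complex.I * (c * Complex.I) = -c := fun c => by
      linear_combination c * Complex.I_mul_I
    simp only [Fin.sum_univ_three, mul_add, add_mul, mul_smul_comm, smul_mul_assoc, crossMatrix]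
    fin_cases α
    · simp only [Fin.zero_eta, Matrix.cons_val, h01, h20, smul_add, smul_sub,
        smul_smul, hI2, mul_comm Complex.I]
      module
    · simp only [Fin.mk_one, Matrix.cons_val, h01, h12, smul_add, smul_sub,
        smul_smul, hI2, mul_comm Complex.I]
      module
    · simp only [Fin.reduceFinMk, Matrix.cons_val, h20, h12, smul_add, smul_sub,
        smul_smul, hI2, mul_comm Complex.I]
      module
  · have : siteSpin m k α * (∑ γ, (s γ : ℂ) • siteSpin m i γ) =
        (∑ γ, (s γ : ℂ) • siteSpin m i γ) * siteSpin m k α := by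
      simp only [Finset.mul_sum, Finset.sum_mul, mul_smul_comm, smul_mul_assoc,
        siteSpin_commute hki]
    rw [this, sub_self, smul_zero]

theorem crossMatrix_conjTranspose {κ : Type*} {X : Fin 3 → Matrix κ κ ℂ}
    (hX : ∀ α, (X α)ᴴ = X α) (s : Fin 3 → ℝ) (α : Fin 3) :
    (crossMatrix X s α)ᴴ = crossMatrix X s α := by
  fin_cases α <;>
  simp [crossMatrix, Matrix.conjTranspose_sub, Matrix.conjTranspose_smul, hX]

/-- The commutator of the Hamiltonian with `s · S_i`. -/
theorem hamiltonian_commutator (J : Fin N → Fin N → Fin 3 → Fin 3 → ℝ) (h : Fin N → Fin 3 → ℝ)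
    (hJ : ∀ i j α β, J i j α β = J j i β α) (i : Fin N) (s : Fin 3 → ℝ) :
    Complex.I • (hamiltonian m J h * (∑ γ, (s γ : ℂ) • siteSpin m i γ) -
      (∑ γ, (s γ : ℂ) • siteSpin m i γ) * hamiltonian m J h) =
    -((1 / (2 * spinVal m) : ℝ) : ℂ) • (∑ j, ∑ α, ∑ β, (J i j α β : ℂ) •
      (siteSpin m j β * crossMatrix (siteSpin m i) s α +
        crossMatrix (siteSpin m i) s α * siteSpin m j β)) -
      ∑ α, (h i α : ℂ) • crossMatrix (siteSpin m i) s α := by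
  set Y := ∑ γ, (s γ : ℂ) • siteSpin m i γ with hY
  set B := crossMatrix (siteSpin m i) s with hB
  have hC : ∀ k α, Complex.I • (siteSpin m k α * Y - Y * siteSpin m k α) =
      if k = i then B α else 0 := fun k α => siteSpin_commutator_sum i k α s
  -- Leibniz rule for the derivation i[·, Y].
  have hCC : ∀ k l α β, Complex.I • (siteSpin m k α * siteSpin m l β * Y -
      Y * (siteSpin m k α * siteSpin m l β)) =
      siteSpin m k α * (if l = i then B β else 0) +
        (if k = i then B α else 0) * siteSpin m l β := fun k l α β => by
    rw [← hC, ← hC, mul_smul_comm, smul_mul_assoc, ← smul_add]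
    congr 1
    noncomm_ring
  have e1 : Complex.I • ((∑ k, ∑ l, ∑ α, ∑ β, (J k l α β : ℂ) •
      (siteSpin m k α * siteSpin m l β)) * Y - Y * (∑ k, ∑ l, ∑ α, ∑ β, (J k l α β : ℂ) •
      (siteSpin m k α * siteSpin m l β))) =
      ∑ k, ∑ l, ∑ α, ∑ β, (J k l α β : ℂ) • (siteSpin m k α * (if l = i then B β else 0) +
        (if k = i then B α else 0) * siteSpin m l β) := by
    simp only [Finset.sum_mul, Finset.mul_sum, ← Finset.sum_sub_distrib, Finset.smul_sum, ← hCC]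
    refine Finset.sum_congr rfl fun k _ => Finset.sum_congr rfl fun l _ =>
      Finset.sum_congr rfl fun α _ => Finset.sum_congr rfl fun β _ => ?_
    rw [smul_mul_assoc, mul_smul_comm, ← smul_sub, smul_comm]
  -- The double sum collapses to terms with k = i or l = i; the symmetry of J carries both to row i,
  -- as a symmetrized product. A self-coupling j = i needs no separate treatment.
  have e2 : ∑ k, ∑ l, ∑ α, ∑ β, (J k l α β : ℂ) • (siteSpin m k α * (if l = i then B β else 0) +
        (if k = i then B α else 0) * siteSpin m l β) =
      ∑ j, ∑ α, ∑ β, (J i j α β : ℂ) • (siteSpin m j β * B α + B α * siteSpin m j β) := by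
    simp only [smul_add, Finset.sum_add_distrib]
    congr 1
    · refine Finset.sum_congr rfl fun j _ => ?_
      rw [Finset.sum_eq_single i (fun l _ hl => by simp [hl]) (by simp), Finset.sum_comm]
      simp only [if_true, hJ j i]
    · rw [Finset.sum_eq_single i (fun l _ hl => by simp [hl]) (by simp)]
      simp only [if_true]
  have e3 : Complex.I • ((∑ k, ∑ α, (h k α : ℂ) • siteSpin m k α) * Y -
      Y * (∑ k, ∑ α, (h k α : ℂ) • siteSpin m k α)) = ∑ α, (h i α : ℂ) • B α := by
    calc _ = ∑ k, ∑ α, (h k α : ℂ) • (if k = i then B α else 0) := by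
          simp only [Finset.sum_mul, Finset.mul_sum, ← Finset.sum_sub_distrib, Finset.smul_sum,
            ← hC]
          refine Finset.sum_congr rfl fun k _ => Finset.sum_congr rfl fun α _ => ?_
          rw [smul_mul_assoc, mul_smul_comm, ← smul_sub, smul_comm]
      _ = _ := by
          rw [Finset.sum_eq_single i (fun l _ hl => by simp [hl]) (by simp)]
          simp only [if_true]
  rw [hamiltonian, ← e2, ← e1, ← e3, sub_mul, mul_sub, smul_mul_assoc, mul_smul_comm]
  module

end Tensor

/-! ### Expectations and adjoints -/

section Expectation

variable {κ : Type*} [Fintype κ] [DecidableEq κ]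

theorem inner_toEuclideanLin_left (A : Matrix κ κ ℂ) (x y : EuclideanSpace ℂ κ) :
    inner ℂ (Matrix.toEuclideanLin A x) y = inner ℂ x (Matrix.toEuclideanLin Aᴴ y) := by
  rw [Matrix.toEuclideanLin_conjTranspose_eq_adjoint, LinearMap.adjoint_inner_right]

theorem toEuclideanLin_mul_apply (A B : Matrix κ κ ℂ) (x : EuclideanSpace ℂ κ) :
    Matrix.toEuclideanLin (A * B) x = Matrix.toEuclideanLin A (Matrix.toEuclideanLin B x) := by
  rw [Matrix.toLpLin_mul_same]
  rfl

theorem toEuclideanLin_coord (A : Matrix κ κ ℂ) (x : EuclideanSpace ℂ κ) (k : κ) :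
    Matrix.toEuclideanLin A x k = ∑ l, A k l * x l := rfl

theorem inner_self_eq_ofReal {V : Type*} [NormedAddCommGroup V] [InnerProductSpace ℂ V] (x : V) :
    inner ℂ x x = ((‖x‖ ^ 2 : ℝ) : ℂ) := by
  rw [inner_self_eq_norm_sq_to_K, Complex.ofReal_pow]
  rfl

theorem inner_eq_sum {κ : Type*} [Fintype κ] (x y : EuclideanSpace ℂ κ) :
    inner ℂ x y = ∑ k, starRingEnd ℂ (x k) * y k := by
  rw [PiLp.inner_apply]
  exact Finset.sum_congr rfl fun k _ => by simp [mul_comm]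

theorem expectation_eq_inner {A : Matrix κ κ ℂ} (hA : Aᴴ = A) (x : EuclideanSpace ℂ κ) :
    expectation A x = inner ℂ (Matrix.toEuclideanLin A x) x := by
  rw [inner_toEuclideanLin_left, hA, expectation]

theorem expectation_sub_re (A B : Matrix κ κ ℂ) (x : EuclideanSpace ℂ κ) :
    (expectation (A - B) x).re = (expectation A x).re - (expectation B x).re := by
  rw [expectation, map_sub, LinearMap.sub_apply, inner_sub_right, Complex.sub_re]
  rfl

theorem expectation_smul_re (a : ℝ) (A : Matrix κ κ ℂ) (x : EuclideanSpace ℂ κ) :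
    (expectation ((a : ℂ) • A) x).re = a * (expectation A x).re := by
  rw [expectation, map_smul, LinearMap.smul_apply, inner_smul_right, Complex.re_ofReal_mul]
  rfl

theorem expectation_sum_re {ι : Type*} (u : Finset ι) (A : ι → Matrix κ κ ℂ)
    (x : EuclideanSpace ℂ κ) :
    (expectation (∑ k ∈ u, A k) x).re = ∑ k ∈ u, (expectation (A k) x).re := by
  simp only [expectation, map_sum, LinearMap.sum_apply, inner_sum, Complex.re_sum]

theorem expectation_mul {A : Matrix κ κ ℂ} (hA : Aᴴ = A) (B : Matrix κ κ ℂ)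
    (x : EuclideanSpace ℂ κ) : expectation (A * B) x =
      inner ℂ (Matrix.toEuclideanLin A x) (Matrix.toEuclideanLin B x) := by
  rw [inner_toEuclideanLin_left, hA, expectation, toEuclideanLin_mul_apply]

end Expectation

/-! ### Product states -/

section ProductState

variable {N m : ℕ}

theorem inner_productState (φ ψ : Fin N → SiteSpace m) :
    inner ℂ (productState φ) (productState ψ) = ∏ i, inner ℂ (φ i) (ψ i) := by
  simp only [inner_eq_sum, productState, map_prod, ← Finset.prod_mul_distrib]
  rw [Finset.prod_univ_sum, Fintype.piFinset_univ]

theorem toEuclideanLin_tensorMatrix_productState (A : Fin N → SiteMatrix m)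
    (ψ : Fin N → SiteSpace m) :
    Matrix.toEuclideanLin (tensorMatrix A) (productState ψ) =
      productState fun i => Matrix.toEuclideanLin (A i) (ψ i) := by
  ext k
  rw [toEuclideanLin_coord]
  simp only [productState, toEuclideanLin_coord, tensorMatrix, ← Finset.prod_mul_distrib]
  rw [Finset.prod_univ_sum, Fintype.piFinset_univ]

theorem norm_productState {ψ : Fin N → SiteSpace m} (hψ : ∀ i, ‖ψ i‖ = 1) :
    ‖productState ψ‖ = 1 := by
  have h : inner ℂ (productState ψ) (productState ψ) = (1 : ℂ) := by
    rw [inner_productState]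
    exact Finset.prod_eq_one fun i _ => by simp [hψ i]
  rw [inner_self_eq_ofReal] at h
  have h' : ‖productState ψ‖ ^ 2 = 1 := by exact_mod_cast h
  exact (pow_eq_one_iff_of_nonneg (norm_nonneg _) two_ne_zero).1 h'

theorem expectation_siteSpin_productState {ψ : Fin N → SiteSpace m} (hψ : ∀ i, ‖ψ i‖ = 1)
    (i : Fin N) (α : Fin 3) :
    expectation (siteSpin m i α) (productState ψ) = expectation (spinMatrix m α) (ψ i) := by
  rw [expectation, siteSpin, toEuclideanLin_tensorMatrix_productState, inner_productState,
    ← Finset.mul_prod_erase _ _ (Finset.mem_univ i), Finset.prod_eq_one, mul_one,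
    Pi.mulSingle_eq_same, expectation]
  intro j hj
  rw [Pi.mulSingle_eq_of_ne (Finset.ne_of_mem_erase hj), Matrix.toLpLin_one]
  simp [hψ j]

end ProductState

/-! ### Schrödinger evolution -/

section Dynamics

variable {N m : ℕ} {J₀ : ℝ} {J : ℝ → Fin N → Fin N → Fin 3 → Fin 3 → ℝ}
  {h : ℝ → Fin N → Fin 3 → ℝ} {Ψ : ℝ → ChainSpace N m}

theorem IsPrimitive.congr_left {E : Type*} [NormedAddCommGroup E] [NormedSpace ℝ E]
    {f g f' : ℝ → E} (hf : IsPrimitive f f') (hfg : ∀ t, 0 ≤ t → f t = g t) :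
    IsPrimitive g f' :=
  ⟨hf.integrable, fun t ht => by rw [← hfg t ht, ← hfg 0 le_rfl, hf.eq_add_integral t ht]⟩

theorem hamiltonian_conjTranspose {J : Fin N → Fin N → Fin 3 → Fin 3 → ℝ}
    (hJ : ∀ i j α β, J i j α β = J j i β α) (h : Fin N → Fin 3 → ℝ) :
    (hamiltonian m J h)ᴴ = hamiltonian m J h := by
  have e : (∑ i, ∑ j, ∑ α, ∑ β, (J i j α β : ℂ) • (siteSpin m i α * siteSpin m j β))ᴴ =
      ∑ i, ∑ j, ∑ α, ∑ β, (J i j α β : ℂ) • (siteSpin m i α * siteSpin m j β) := by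
    simp only [Matrix.conjTranspose_sum, Matrix.conjTranspose_smul, Matrix.conjTranspose_mul,
      siteSpin_conjTranspose, RCLike.star_def, Complex.conj_ofReal]
    rw [Finset.sum_comm]
    refine Finset.sum_congr rfl fun i _ => Finset.sum_congr rfl fun j _ => ?_
    rw [Finset.sum_comm]
    exact Finset.sum_congr rfl fun α _ => Finset.sum_congr rfl fun β _ => by rw [hJ]
  rw [hamiltonian, Matrix.conjTranspose_sub, Matrix.conjTranspose_smul, e]
  simp only [Matrix.conjTranspose_sum, Matrix.conjTranspose_smul, siteSpin_conjTranspose,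
    RCLike.star_def, Complex.conj_ofReal, map_neg]

/-- H(u)Ψ(u) is a finite combination of continuous vectors, fixed matrices applied to Ψ(u), with
integrable scalar coefficients. -/
theorem Admissible.hamiltonian_integrable (hJ : Admissible J₀ J h)
    (hΨ : ContinuousOn Ψ (Set.Ici 0)) {t : ℝ} (ht : 0 ≤ t) :
    IntervalIntegrable
      (fun u => Matrix.toEuclideanLin (hamiltonian m (J u) (h u)) (Ψ u)) volume 0 t := by
  have hc : ∀ A : ChainMatrix N m,
      ContinuousOn (fun u => Matrix.toEuclideanLin A (Ψ u)) (Set.uIcc 0 t) := fun A =>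
    (LinearMap.continuous_of_finiteDimensional _).comp_continuousOn
      (hΨ.mono (by rw [Set.uIcc_of_le ht]; exact Set.Icc_subset_Ici_self))
  have key : ∀ (f : ℝ → ℝ) (A : ChainMatrix N m), IntervalIntegrable f volume 0 t →
      IntervalIntegrable (fun u => (f u : ℂ) • Matrix.toEuclideanLin A (Ψ u)) volume 0 t :=
    fun f A hf => IntervalIntegrable.smul_continuousOn (f := fun u => (f u : ℂ))
      ⟨hf.1.ofReal, hf.2.ofReal⟩ (hc A)
  have e : (fun u => Matrix.toEuclideanLin (hamiltonian m (J u) (h u)) (Ψ u)) =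
      (-((1 / (2 * spinVal m) : ℝ) : ℂ)) • (∑ i, ∑ j, ∑ α, ∑ β, fun u =>
        (J u i j α β : ℂ) • Matrix.toEuclideanLin (siteSpin m i α * siteSpin m j β) (Ψ u)) -
      ∑ i, ∑ α, fun u => (h u i α : ℂ) • Matrix.toEuclideanLin (siteSpin m i α) (Ψ u) := by
    funext u
    simp only [hamiltonian, map_sub, map_smul, map_sum, LinearMap.sub_apply, LinearMap.smul_apply,
      LinearMap.sum_apply, Pi.sub_apply, Pi.smul_apply, Finset.sum_apply]
  rw [e]
  refine IntervalIntegrable.sub (IntervalIntegrable.smul ?_ _) ?_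
  · exact IntervalIntegrable.sum _ fun i _ => IntervalIntegrable.sum _ fun j _ =>
      IntervalIntegrable.sum _ fun α _ => IntervalIntegrable.sum _ fun β _ =>
        key _ _ (hJ.integrable_coupling t ht i j α β)
  · exact IntervalIntegrable.sum _ fun i _ => IntervalIntegrable.sum _ fun α _ =>
      key _ _ (hJ.integrable_field t ht i α)

theorem IsSchrodingerSolution.isPrimitive (hJ : Admissible J₀ J h)
    (hΨ : IsSchrodingerSolution m J h Ψ) :
    IsPrimitive Ψ
      (fun u => -Complex.I • Matrix.toEuclideanLin (hamiltonian m (J u) (h u)) (Ψ u)) where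
  integrable _ ht := (hJ.hamiltonian_integrable hΨ.1 ht).smul (-Complex.I)
  eq_add_integral t ht := by
    rw [intervalIntegral.integral_smul, neg_smul, ← sub_eq_add_neg]
    exact hΨ.2 t ht

/-- Heisenberg's equation for the expectation of a time-independent observable. -/
theorem IsSchrodingerSolution.expectation_isPrimitive (hJ : Admissible J₀ J h)
    (hΨ : IsSchrodingerSolution m J h Ψ) (A : ChainMatrix N m) :
    IsPrimitive (fun t => expectation A (Ψ t))
      (fun t => expectation (Complex.I •
        (hamiltonian m (J t) (h t) * A - A * hamiltonian m (J t) (h t))) (Ψ t)) := by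
  -- The product rule is available for scalar functions, so the expectation is differentiated in
  -- coordinates.
  have hcoord : ∀ k, IsPrimitive (fun t => Ψ t k) (fun t =>
      (-Complex.I • Matrix.toEuclideanLin (hamiltonian m (J t) (h t)) (Ψ t)) k) := fun k =>
    (hΨ.isPrimitive hJ).clm_comp ((EuclideanSpace.proj k :
      ChainSpace N m →L[ℂ] ℂ).restrictScalars ℝ)
  have h1 := IsPrimitive.sum Finset.univ fun k _ => ((hcoord k).conj).mul
    (IsPrimitive.sum Finset.univ fun l _ => (hcoord l).const_mul (A k l))
  refine (h1.congr fun t ht => ?_).congr_left fun t ht => ?_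
  · set H := hamiltonian m (J t) (h t) with hH
    have hH' : Hᴴ = H := hamiltonian_conjTranspose (hJ.symm t ht) _
    simp only [← toEuclideanLin_coord, Finset.sum_add_distrib, ← inner_eq_sum]
    simp only [expectation, map_smul, map_sub, LinearMap.smul_apply, LinearMap.sub_apply,
      toEuclideanLin_mul_apply, inner_smul_left, inner_smul_right, inner_sub_right,
      inner_toEuclideanLin_left, hH', map_neg, Complex.conj_I]
    ring
  · simp only [← toEuclideanLin_coord, ← inner_eq_sum]
    rfl

theorem IsSchrodingerSolution.norm_eq (hJ : Admissible J₀ J h)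
    (hΨ : IsSchrodingerSolution m J h Ψ) {t : ℝ} (ht : 0 ≤ t) : ‖Ψ t‖ = ‖Ψ 0‖ := by
  have h1 := ((hΨ.expectation_isPrimitive hJ 1).congr
    (g' := fun _ => 0) fun t _ => by simp [expectation]).eq_add_integral t ht
  simp only [expectation, Matrix.toLpLin_one, LinearMap.id_apply, inner_self_eq_ofReal,
    intervalIntegral.integral_zero, add_zero] at h1
  have h2 : ‖Ψ t‖ ^ 2 = ‖Ψ 0‖ ^ 2 := by exact_mod_cast h1
  exact (pow_left_inj₀ (norm_nonneg _) (norm_nonneg _) two_ne_zero).1 h2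

end Dynamics

/-! ### The spread about a classical configuration -/

section Deviation

variable {N m : ℕ}

/-- The vector `(S_i^α / S - s_i^α) v`. -/
def deviation (s : Fin N → Fin 3 → ℝ) (v : ChainSpace N m) (i : Fin N) (α : Fin 3) :
    ChainSpace N m :=
  ((1 / spinVal m : ℝ) : ℂ) • Matrix.toEuclideanLin (siteSpin m i α) v - (s i α : ℂ) • v

/-- The variance `∑_α ‖(S_i^α / S - s_i^α) v‖²`. -/
def spread (s : Fin N → Fin 3 → ℝ) (v : ChainSpace N m) (i : Fin N) : ℝ :=
  ∑ α, ‖deviation s v i α‖ ^ 2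

theorem spread_nonneg (s : Fin N → Fin 3 → ℝ) (v : ChainSpace N m) (i : Fin N) :
    0 ≤ spread s v i := Finset.sum_nonneg fun _ _ => sq_nonneg _

theorem norm_deviation_le {s : Fin N → Fin 3 → ℝ} {v : ChainSpace N m} {i : Fin N} {M : ℝ}
    (hM : spread s v i ≤ M) (α : Fin 3) : ‖deviation s v i α‖ ≤ Real.sqrt M :=
  Real.le_sqrt_of_sq_le ((Finset.single_le_sum (f := fun α => ‖deviation s v i α‖ ^ 2)
    (fun _ _ => sq_nonneg _) (Finset.mem_univ α)).trans hM)

theorem spinVal_pos (hm : 1 ≤ m) : 0 < spinVal m := by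
  have : (1 : ℝ) ≤ m := by exact_mod_cast hm
  unfold spinVal
  linarith

theorem sum_norm_siteSpin_sq (v : ChainSpace N m) (i : Fin N) :
    ∑ α, ‖Matrix.toEuclideanLin (siteSpin m i α) v‖ ^ 2 =
      spinVal m * (spinVal m + 1) * ‖v‖ ^ 2 := by
  have h1 : expectation (∑ α, siteSpin m i α * siteSpin m i α) v =
      ((∑ α, ‖Matrix.toEuclideanLin (siteSpin m i α) v‖ ^ 2 : ℝ) : ℂ) := by
    simp only [expectation, map_sum, LinearMap.sum_apply, inner_sum]
    push_cast
    refine Finset.sum_congr rfl fun α _ => ?_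
    have := expectation_mul (siteSpin_conjTranspose (m := m) i α) (siteSpin m i α) v
    rw [inner_self_eq_ofReal] at this
    rw [← Complex.ofReal_pow]
    exact this
  rw [sum_siteSpin_sq] at h1
  simp only [expectation, map_smul, LinearMap.smul_apply, Matrix.toLpLin_one, LinearMap.id_apply,
    inner_smul_right, inner_self_eq_ofReal] at h1
  exact_mod_cast h1.symm

/-- Expanding the squares, the quadratic terms add up to S(S+1)/S² = 1 + 1/S by the Casimir
identity; the 1/S is the quantum fluctuation that remains in a classical state. -/
theorem spread_eq (hm : 1 ≤ m) {s : Fin N → Fin 3 → ℝ} {v : ChainSpace N m} (hv : ‖v‖ = 1)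
    (i : Fin N) : spread s v i = 1 + 1 / spinVal m + ∑ α, s i α ^ 2 -
      2 / spinVal m * ∑ α, s i α * (expectation (siteSpin m i α) v).re := by
  have hS := spinVal_pos hm
  have h1 : ∀ α, ‖deviation s v i α‖ ^ 2 =
      (1 / spinVal m) ^ 2 * ‖Matrix.toEuclideanLin (siteSpin m i α) v‖ ^ 2 + s i α ^ 2 -
        2 / spinVal m * (s i α * (expectation (siteSpin m i α) v).re) := fun α => by
    rw [deviation, @norm_sub_sq ℂ, norm_smul, norm_smul, hv, inner_smul_left, inner_smul_right,
      ← expectation_eq_inner (siteSpin_conjTranspose i α)]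
    simp only [Complex.norm_real, Real.norm_eq_abs, mul_pow, sq_abs, Complex.conj_ofReal,
      RCLike.re_to_complex, Complex.re_ofReal_mul]
    ring
  rw [spread, Finset.sum_congr rfl fun α _ => h1 α, Finset.sum_sub_distrib,
    Finset.sum_add_distrib, ← Finset.mul_sum, ← Finset.mul_sum, sum_norm_siteSpin_sq, hv]
  field_simp

/-- As s_i × s_i = 0, S_i may be replaced by S_i - S s_i in S_i × s_i. The vector is thus S times
first order in the deviations, which makes the growth rate of the spread quadratic in them. -/
theorem crossMatrix_deviation (hm : 1 ≤ m) (s : Fin N → Fin 3 → ℝ) (v : ChainSpace N m)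
    (i : Fin N) {M : ℝ} (hs : ∀ α, |s i α| ≤ 1) (hM : spread s v i ≤ M) (α : Fin 3) :
    ‖Matrix.toEuclideanLin (crossMatrix (siteSpin m i) (s i) α) v‖ ≤
      spinVal m * (2 * Real.sqrt M) := by
  have hS := spinVal_pos hm
  have hS' : (spinVal m : ℂ) ≠ 0 := by exact_mod_cast hS.ne'
  have key : ∀ β γ, ‖(s i β : ℂ) • deviation s v i γ - (s i γ : ℂ) • deviation s v i β‖ ≤
      2 * Real.sqrt M := fun β γ => by
    have b : ∀ β γ, ‖(s i β : ℂ) • deviation s v i γ‖ ≤ Real.sqrt M := fun β γ => by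
      rw [norm_smul, Complex.norm_real, Real.norm_eq_abs, ← one_mul (Real.sqrt M)]
      exact mul_le_mul (hs β) (norm_deviation_le hM γ) (norm_nonneg _) zero_le_one
    exact (norm_sub_le _ _).trans (by linarith [b β γ, b γ β])
  have key' : ∀ β γ, ‖Matrix.toEuclideanLin ((s i β : ℂ) • siteSpin m i γ -
      (s i γ : ℂ) • siteSpin m i β) v‖ ≤ spinVal m * (2 * Real.sqrt M) := fun β γ => by
    have e : Matrix.toEuclideanLin ((s i β : ℂ) • siteSpin m i γ -
        (s i γ : ℂ) • siteSpin m i β) v = (spinVal m : ℂ) •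
        ((s i β : ℂ) • deviation s v i γ - (s i γ : ℂ) • deviation s v i β) := by
      simp only [deviation, map_sub, map_smul, LinearMap.sub_apply, LinearMap.smul_apply, smul_sub,
        smul_smul]
      have e1 : ∀ c : ℂ, (spinVal m : ℂ) * (c * ((1 / spinVal m : ℝ) : ℂ)) = c := fun c => by
        push_cast
        field_simp
      rw [e1, e1]
      module
    rw [e, norm_smul, Complex.norm_real, Real.norm_of_nonneg hS.le]
    exact mul_le_mul_of_nonneg_left (key β γ) hS.le
  fin_cases α
  · exact key' 2 1
  · exact key' 0 2
  · exact key' 1 0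

/-- The rate of change of `s_i · ⟨S_i⟩` when both `s` and the state evolve. -/
theorem sum_torque_mul_expectation_add (hm : 1 ≤ m) {J : Fin N → Fin N → Fin 3 → Fin 3 → ℝ}
    {h : Fin N → Fin 3 → ℝ} (hJ : ∀ i j α β, J i j α β = J j i β α) (s : Fin N → Fin 3 → ℝ)
    (v : ChainSpace N m) (i : Fin N) :
    ∑ γ, (torque J h s i γ * (expectation (siteSpin m i γ) v).re +
      s i γ * (expectation (Complex.I • (hamiltonian m J h * siteSpin m i γ -
        siteSpin m i γ * hamiltonian m J h)) v).re) =
    -∑ j, ∑ α, ∑ β, J i j α β *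
      (inner ℂ (Matrix.toEuclideanLin (crossMatrix (siteSpin m i) (s i) α) v)
        (deviation s v j β)).re := by
  have hS := spinVal_pos hm
  set B := crossMatrix (siteSpin m i) (s i) with hB
  have hBB : ∀ α, (B α)ᴴ = B α := crossMatrix_conjTranspose (siteSpin_conjTranspose i) (s i)
  set e : Fin 3 → ℝ := fun γ => (expectation (siteSpin m i γ) v).re with he
  set b : Fin 3 → ℝ := fun α => (expectation (B α) v).re with hb
  set c : Fin N → Fin 3 → Fin 3 → ℝ := fun j α β => (inner ℂ (Matrix.toEuclideanLin (B α) v)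
    (Matrix.toEuclideanLin (siteSpin m j β) v)).re with hc
  have hbe : ∀ α, b α = crossProduct e (s i) α := fun α => by
    simp only [hb, hB, he, cross_apply]
    fin_cases α <;>
    simp only [crossMatrix, Fin.zero_eta, Fin.mk_one, Fin.reduceFinMk, Matrix.cons_val,
      expectation_sub_re, expectation_smul_re, mul_comm]
  have h1 : ∑ γ, torque J h s i γ * e γ = ∑ α, effectiveField J h s i α * b α := by
    simp only [hbe, torque, cross_apply, Fin.sum_univ_three, Matrix.cons_val]
    ring
  have h2 : ∑ α, effectiveField J h s i α * b α =
      ∑ α, h i α * b α + ∑ j, ∑ α, ∑ β, J i j α β * (s j β * b α) := by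
    simp only [effectiveField, add_mul, Finset.sum_add_distrib, Finset.sum_mul, mul_assoc]
    rw [add_right_inj]
    exact Finset.sum_comm
  have h3 : ∑ γ, s i γ * (expectation (Complex.I • (hamiltonian m J h * siteSpin m i γ -
        siteSpin m i γ * hamiltonian m J h)) v).re =
      (expectation (Complex.I • (hamiltonian m J h * (∑ γ, (s i γ : ℂ) • siteSpin m i γ) -
      (∑ γ, (s i γ : ℂ) • siteSpin m i γ) * hamiltonian m J h)) v).re := by
    simp only [Finset.mul_sum, Finset.sum_mul, ← Finset.sum_sub_distrib, Finset.smul_sum,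
      mul_smul_comm, smul_mul_assoc, ← smul_sub]
    rw [expectation_sum_re]
    refine Finset.sum_congr rfl fun γ _ => ?_
    rw [smul_comm, expectation_smul_re]
  -- The two orderings are adjoint to each other, so their sum has expectation twice a real part,
  -- also for j = i: no ordering correction of relative size 1/S appears.
  have h4 : ∀ j α β, (expectation (siteSpin m j β * B α + B α * siteSpin m j β) v).re =
      2 * c j α β := fun j α β => by
    have e1 := expectation_mul (siteSpin_conjTranspose (m := m) j β) (B α) v
    have e2 := expectation_mul (hBB α) (siteSpin m j β) v
    have e3 : expectation (siteSpin m j β * B α + B α * siteSpin m j β) v =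
        expectation (siteSpin m j β * B α) v + expectation (B α * siteSpin m j β) v := by
      simp only [expectation, map_add, LinearMap.add_apply, inner_add_right]
    rw [e3, e1, e2, ← inner_conj_symm, Complex.add_re, Complex.conj_re]
    simp only [hc]
    ring
  have h5 : (expectation (Complex.I • (hamiltonian m J h * (∑ γ, (s i γ : ℂ) • siteSpin m i γ) -
      (∑ γ, (s i γ : ℂ) • siteSpin m i γ) * hamiltonian m J h)) v).re =
      -(1 / spinVal m) * ∑ j, ∑ α, ∑ β, J i j α β * c j α β - ∑ α, h i α * b α := by
    rw [hamiltonian_commutator J h hJ]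
    rw [← Complex.ofReal_neg, expectation_sub_re, expectation_smul_re]
    simp only [expectation_sum_re, expectation_smul_re, h4, ← hB]
    congr 1
    simp only [mul_left_comm _ (2 : ℝ), ← Finset.mul_sum]
    field_simp
  have h6 : ∀ j α β, (inner ℂ (Matrix.toEuclideanLin (B α) v) (deviation s v j β)).re =
      1 / spinVal m * c j α β - s j β * b α := fun j α β => by
    rw [deviation, inner_sub_right, inner_smul_right, inner_smul_right,
      ← expectation_eq_inner (hBB α), Complex.sub_re, Complex.re_ofReal_mul,
      Complex.re_ofReal_mul]
  -- The terms with h cancel between the torque and the commutator. The mean-field term s_j b and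
  -- the quantum term c/S combine into the deviation at site j.
  rw [Finset.sum_add_distrib, h1, h2, h3, h5]
  simp only [h6, mul_sub, Finset.sum_sub_distrib, mul_left_comm _ (1 / spinVal m),
    ← Finset.mul_sum]
  ring

end Deviation

/-! ### Gronwall estimate for the spread -/

section Bound

variable {N m : ℕ} {J₀ : ℝ} {J : ℝ → Fin N → Fin N → Fin 3 → Fin 3 → ℝ}
  {h : ℝ → Fin N → Fin 3 → ℝ} {Ψ : ℝ → ChainSpace N m} {s : ℝ → Fin N → Fin 3 → ℝ}

/-- The variances of the spins about the classical trajectory grow at most exponentially, at a rate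
which depends on `J₀` only. -/
theorem spread_le (hm : 1 ≤ m) (hJ : Admissible J₀ J h) (hΨ : IsSchrodingerSolution m J h Ψ)
    (hs : IsClassicalTrajectory J h s) (hΨ0 : ‖Ψ 0‖ = 1) (hs0 : ∀ i, ∑ α, s 0 i α ^ 2 = 1)
    {δ : ℝ} (hδ : 0 ≤ δ) (hi : ∀ i, spread (s 0) (Ψ 0) i ≤ δ) (i : Fin N) {t : ℝ} (ht : 0 ≤ t) :
    spread (s t) (Ψ t) i ≤ δ * Real.exp (4 * |J₀| * t) := by
  have hS := spinVal_pos hm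
  have hsq : ∀ t, 0 ≤ t → ∀ i, ∑ α, s t i α ^ 2 = 1 := fun t ht i => by
    rw [hs.sum_sq_eq hJ i ht, hs0 i]
  have hD : ∀ i, IsPrimitive (fun t => spread (s t) (Ψ t) i) (fun t =>
      2 / spinVal m * ∑ j, ∑ α, ∑ β, J t i j α β *
      (inner ℂ (Matrix.toEuclideanLin (crossMatrix (siteSpin m i) (s t i) α) (Ψ t))
        (deviation (s t) (Ψ t) j β)).re) := fun i => by
    have h1 := (IsPrimitive.const (1 + 1 / spinVal m + 1)).add
      ((IsPrimitive.sum Finset.univ fun γ _ => (hs.isPrimitive hJ i γ).mul_real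
        (hΨ.expectation_isPrimitive hJ (siteSpin m i γ)).re).const_mul_real (-(2 / spinVal m)))
    refine (h1.congr fun t ht => ?_).congr_left fun t ht => ?_
    · rw [sum_torque_mul_expectation_add hm (hJ.symm t ht)]
      ring
    · rw [spread_eq hm ((hΨ.norm_eq hJ ht).trans hΨ0), hsq t ht]
      ring
  refine le_mul_exp_of_primitive_le (by positivity) hδ hD (fun i t _ => spread_nonneg _ _ _)
    (fun i t ht M hM => ?_) hi i ht
  have hM0 : 0 ≤ M := (spread_nonneg _ _ _).trans (hM i)
  -- Each inner product is at most (S·2√M)·√M; the factor S cancels the prefactor 2/S and leaves the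
  -- rate 4 J₀.
  have h1 := abs_coupling_sum_le (hJ.bound t ht i) (C := spinVal m * (2 * M)) (by positivity)
    (c := fun j α β =>
      (inner ℂ (Matrix.toEuclideanLin (crossMatrix (siteSpin m i) (s t i) α) (Ψ t))
        (deviation (s t) (Ψ t) j β)).re) fun j α β => by
      refine (Complex.abs_re_le_norm _).trans ((norm_inner_le_norm _ _).trans ?_)
      have b1 := crossMatrix_deviation hm (s t) (Ψ t) i (abs_le_one_of_sum_sq (hsq t ht i)) (hM i) α
      have b2 := norm_deviation_le (hM j) β
      refine (mul_le_mul b1 b2 (norm_nonneg _) (by positivity)).trans_eq ?_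
      linear_combination (2 * spinVal m) * Real.mul_self_sqrt hM0
  have h2 := (abs_le.1 h1).2
  rw [abs_of_nonneg (hJ.nonneg i)]
  calc _ ≤ 2 / spinVal m * (J₀ * (spinVal m * (2 * M))) :=
        mul_le_mul_of_nonneg_left h2 (by positivity)
    _ = 4 * J₀ * M := by
        field_simp
        ring

end Bound

/-! ### From the spread to correlations -/

section Correlation

variable {N m : ℕ}

/-- The Casimir identity gives √(S(S+1)) ≤ 2S for S ≥ 1/2. This crude factor 2 per operator avoids
the spectrum and causes the 2^n below. -/
theorem norm_siteSpin_le (hm : 1 ≤ m) (i : Fin N) (α : Fin 3) (v : ChainSpace N m) :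
    ‖Matrix.toEuclideanLin (siteSpin m i α) v‖ ≤ 2 * spinVal m * ‖v‖ := by
  have hS := spinVal_pos hm
  have hS2 : 1 / 2 ≤ spinVal m := by
    have : (1 : ℝ) ≤ m := by exact_mod_cast hm
    unfold spinVal
    linarith
  refine (sq_le_sq₀ (norm_nonneg _) (by positivity)).1 ?_
  refine (Finset.single_le_sum
    (f := fun α => ‖Matrix.toEuclideanLin (siteSpin m i α) v‖ ^ 2)
    (fun _ _ => sq_nonneg _) (Finset.mem_univ α)).trans ?_
  rw [sum_norm_siteSpin_sq, mul_pow]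
  exact mul_le_mul_of_nonneg_right (by nlinarith) (sq_nonneg _)

/-- Telescoping from the left: the first operator, divided by S, at most doubles the error of the
remaining product, and replacing it by its classical value costs one deviation. The recursion
e_{n+1} ≤ 2e_n + √M is solved by n 2^n √M; no commutation is needed. -/
theorem norm_prod_siteSpin_sub_le (hm : 1 ≤ m) {s : Fin N → Fin 3 → ℝ} {v : ChainSpace N m}
    {M : ℝ} (hs : ∀ i α, |s i α| ≤ 1) (hM : ∀ i, spread s v i ≤ M) {n : ℕ}
    (i : Fin n → Fin N) (α : Fin n → Fin 3) :
    ‖((1 / spinVal m ^ n : ℝ) : ℂ) •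
        Matrix.toEuclideanLin (List.ofFn fun k => siteSpin m (i k) (α k)).prod v -
      ((∏ k, s (i k) (α k) : ℝ) : ℂ) • v‖ ≤ n * 2 ^ n * Real.sqrt M := by
  have hS := spinVal_pos hm
  induction n with
  | zero => simp
  | succ n ih =>
    set P := (List.ofFn fun k : Fin n => siteSpin m (i k.succ) (α k.succ)).prod with hP
    set X := siteSpin m (i 0) (α 0) with hX
    set p := ∏ k : Fin n, s (i k.succ) (α k.succ) with hp
    have hp1 : |p| ≤ 1 := by
      rw [hp, Finset.abs_prod]
      exact Finset.prod_le_one (fun _ _ => abs_nonneg _) fun _ _ => hs _ _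
    have h1 := ih (fun k => i k.succ) fun k => α k.succ
    have e : ((1 / spinVal m ^ (n + 1) : ℝ) : ℂ) • Matrix.toEuclideanLin (X * P) v -
        ((s (i 0) (α 0) * p : ℝ) : ℂ) • v =
        ((1 / spinVal m : ℝ) : ℂ) • Matrix.toEuclideanLin X
          (((1 / spinVal m ^ n : ℝ) : ℂ) • Matrix.toEuclideanLin P v - (p : ℂ) • v) +
        (p : ℂ) • deviation s v (i 0) (α 0) := by
      have e1 : ((1 / spinVal m ^ (n + 1) : ℝ) : ℂ) =
          ((1 / spinVal m : ℝ) : ℂ) * ((1 / spinVal m ^ n : ℝ) : ℂ) := by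
        rw [← Complex.ofReal_mul, pow_succ]
        congr 1
        field_simp
      rw [deviation, toEuclideanLin_mul_apply, map_sub, map_smul, map_smul, e1, Complex.ofReal_mul]
      module
    rw [List.ofFn_succ, List.prod_cons, Fin.prod_univ_succ, e]
    have b1 : ‖((1 / spinVal m : ℝ) : ℂ) • Matrix.toEuclideanLin X
          (((1 / spinVal m ^ n : ℝ) : ℂ) • Matrix.toEuclideanLin P v - (p : ℂ) • v)‖ ≤
        2 * (n * 2 ^ n * Real.sqrt M) := by
      rw [norm_smul, Complex.norm_real, Real.norm_of_nonneg (by positivity)]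
      calc _ ≤ 1 / spinVal m * (2 * spinVal m * (n * 2 ^ n * Real.sqrt M)) := by
            refine mul_le_mul_of_nonneg_left ((norm_siteSpin_le hm _ _ _).trans ?_) (by positivity)
            exact mul_le_mul_of_nonneg_left h1 (by positivity)
        _ = _ := by field_simp
    have b2 : ‖(p : ℂ) • deviation s v (i 0) (α 0)‖ ≤ 1 * Real.sqrt M := by
      rw [norm_smul, Complex.norm_real, Real.norm_eq_abs]
      exact mul_le_mul hp1 (norm_deviation_le (hM _) _) (norm_nonneg _) zero_le_one
    have b3 : (1 : ℝ) ≤ 2 ^ (n + 1) := one_le_pow₀ one_le_two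
    refine (norm_add_le _ _).trans ((add_le_add b1 b2).trans ?_)
    push_cast
    rw [pow_succ] at b3 ⊢
    nlinarith [Real.sqrt_nonneg M]

theorem norm_normalizedCorrelation_sub_le (hm : 1 ≤ m) {s : Fin N → Fin 3 → ℝ}
    {v : ChainSpace N m} (hv : ‖v‖ = 1) {M : ℝ} (hs : ∀ i α, |s i α| ≤ 1)
    (hM : ∀ i, spread s v i ≤ M) {n : ℕ} (i : Fin n → Fin N) (α : Fin n → Fin 3) :
    ‖normalizedCorrelation v i α - ((∏ k, s (i k) (α k) : ℝ) : ℂ)‖ ≤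
      n * 2 ^ n * Real.sqrt M := by
  have e : normalizedCorrelation v i α - ((∏ k, s (i k) (α k) : ℝ) : ℂ) =
      inner ℂ v (((1 / spinVal m ^ n : ℝ) : ℂ) •
        Matrix.toEuclideanLin (List.ofFn fun k => siteSpin m (i k) (α k)).prod v -
      ((∏ k, s (i k) (α k) : ℝ) : ℂ) • v) := by
    rw [inner_sub_right, inner_smul_right, inner_smul_right, inner_self_eq_ofReal, hv,
      normalizedCorrelation, expectation]
    push_cast
    ring
  rw [e]
  refine (norm_inner_le_norm _ _).trans ?_
  rw [hv, one_mul]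
  exact norm_prod_siteSpin_sub_le hm hs hM i α

theorem sum_normalizedSpin_productState_sq (hm : 1 ≤ m) {ψ : Fin N → SiteSpace m}
    (hψ : ∀ i, IsClassicalState (ψ i)) (i : Fin N) :
    ∑ α, normalizedSpin (productState ψ) i α ^ 2 = 1 := by
  have hS := spinVal_pos hm
  simp only [normalizedSpin, expectation_siteSpin_productState fun i => (hψ i).1, div_pow]
  rw [← Finset.sum_div, (hψ i).2, div_self (by positivity)]

theorem spread_eq_normalizedSpin (hm : 1 ≤ m) {s : Fin N → Fin 3 → ℝ} {v : ChainSpace N m}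
    (hv : ‖v‖ = 1) {i : Fin N} (hs : ∑ α, s i α ^ 2 = 1) :
    spread s v i = 2 + 1 / spinVal m - 2 * ∑ α, s i α * normalizedSpin v i α := by
  have hS := spinVal_pos hm
  have e : 2 / spinVal m * ∑ α, s i α * (expectation (siteSpin m i α) v).re =
      2 * ∑ α, s i α * normalizedSpin v i α := by
    rw [Finset.mul_sum, Finset.mul_sum]
    refine Finset.sum_congr rfl fun α _ => ?_
    rw [normalizedSpin]
    field_simp
  rw [spread_eq hm hv, hs, e]
  ring

theorem normalizedCorrelation_one (v : ChainSpace N m) (i : Fin N) (α : Fin 3) :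
    (normalizedCorrelation v (fun _ : Fin 1 => i) fun _ => α).re = normalizedSpin v i α := by
  simp [normalizedCorrelation, normalizedSpin]

variable {J₀ : ℝ} {J : ℝ → Fin N → Fin N → Fin 3 → Fin 3 → ℝ} {h : ℝ → Fin N → Fin 3 → ℝ}

/-- The deviation of the correlations from the classical ones, in terms of the initial
variances. -/
theorem norm_correlation_sub_le (hm : 1 ≤ m) (hJ : Admissible J₀ J h) {Ψ : ℝ → ChainSpace N m}
    {s : ℝ → Fin N → Fin 3 → ℝ} (hΨ : IsSchrodingerSolution m J h Ψ)
    (hs : IsClassicalTrajectory J h s) (hΨ0 : ‖Ψ 0‖ = 1) (hs0 : ∀ i, ∑ α, s 0 i α ^ 2 = 1)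
    {δ : ℝ} (hδ : 0 ≤ δ) (hi : ∀ i, spread (s 0) (Ψ 0) i ≤ δ) {t : ℝ} (ht : 0 ≤ t) {n : ℕ}
    (i : Fin n → Fin N) (α : Fin n → Fin 3) :
    ‖normalizedCorrelation (Ψ t) i α - ((∏ k, s t (i k) (α k) : ℝ) : ℂ)‖ ≤
      n * 2 ^ n * Real.sqrt (δ * Real.exp (4 * |J₀| * t)) :=
  norm_normalizedCorrelation_sub_le hm ((hΨ.norm_eq hJ ht).trans hΨ0)
    (fun i => abs_le_one_of_sum_sq (by rw [hs.sum_sq_eq hJ i ht, hs0 i]))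
    (fun i => spread_le hm hJ hΨ hs hΨ0 hs0 hδ hi i ht) i α

end Correlation

/-! ### The limit of large spin -/

theorem tendsto_one_div_spinVal : Tendsto (fun m : ℕ => 1 / spinVal m) atTop (𝓝 0) := by
  have : Tendsto (fun m : ℕ => 2 * (1 / (m : ℝ))) atTop (𝓝 (2 * 0)) :=
    tendsto_one_div_atTop_nhds_zero_nat.const_mul 2
  rw [mul_zero] at this
  refine this.congr fun m => ?_
  rw [spinVal, one_div_div, mul_one_div]

theorem tendsto_mul_sqrt_mul {ι : Type*} {l : Filter ι} {δ : ι → ℝ} (hδ : Tendsto δ l (𝓝 0))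
    (a b : ℝ) : Tendsto (fun k => a * Real.sqrt (δ k * b)) l (𝓝 0) := by
  have h1 := ((Real.continuous_sqrt.tendsto _).comp (hδ.mul_const b)).const_mul a
  simpa using h1

/-- Started at its own mean spin, a classical state has spread exactly 1/S at every site, so the
error bound depends only on S, n, J₀ and T. -/
theorem correlation_uniform_bound (J₀ : ℝ) (n : ℕ) (T : ℝ) {ε : ℝ} (hε : 0 < ε) :
    ∃ m₀ : ℕ, ∀ m, m₀ ≤ m → 1 ≤ m →
      ∀ (N : ℕ) (J : ℝ → Fin N → Fin N → Fin 3 → Fin 3 → ℝ) (h : ℝ → Fin N → Fin 3 → ℝ),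
      Admissible J₀ J h →
      ∀ (ψ : Fin N → SiteSpace m) (Ψ : ℝ → ChainSpace N m) (s : ℝ → Fin N → Fin 3 → ℝ),
      (∀ i, IsClassicalState (ψ i)) → Ψ 0 = productState ψ → IsSchrodingerSolution m J h Ψ →
      IsClassicalTrajectory J h s → (∀ i α, s 0 i α = normalizedSpin (Ψ 0) i α) →
      ∀ t, 0 ≤ t → t ≤ T → ∀ (i : Fin n → Fin N) (α : Fin n → Fin 3),
        ‖normalizedCorrelation (Ψ t) i α - ((∏ k, s t (i k) (α k) : ℝ) : ℂ)‖ ≤ ε := by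
  have hlim := tendsto_mul_sqrt_mul tendsto_one_div_spinVal (n * 2 ^ n)
    (Real.exp (4 * |J₀| * T))
  obtain ⟨m₀, hm₀⟩ := eventually_atTop.1 (hlim.eventually_le_const hε)
  refine ⟨m₀, fun m hmm hm N J h hJ ψ Ψ s hψ hΨ0 hΨ hs hs0 t ht htT i α => ?_⟩
  have hS := spinVal_pos hm
  have hnorm : ‖Ψ 0‖ = 1 := by rw [hΨ0]; exact norm_productState fun i => (hψ i).1
  have hsq : ∀ i, ∑ α, s 0 i α ^ 2 = 1 := fun i => by
    simp only [hs0, hΨ0]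
    exact sum_normalizedSpin_productState_sq hm hψ i
  have hspread : ∀ i, spread (s 0) (Ψ 0) i ≤ 1 / spinVal m := fun i => by
    rw [spread_eq_normalizedSpin hm hnorm (hsq i)]
    have := hsq i
    simp only [← hs0, ← sq]
    linarith
  refine (norm_correlation_sub_le hm hJ hΨ hs hnorm hsq (by positivity) hspread ht i α).trans
    (le_trans ?_ (hm₀ m hmm))
  gcongr

/-- The trajectory starts at the limit s₀, not at the mean spin for each S, so the initial spread is
not exactly 1/S. It still tends to 2 - 2|s₀|² = 0, because unit length passes to the limit. -/
theorem classical_limit {J₀ : ℝ} {N : ℕ} {J : ℝ → Fin N → Fin N → Fin 3 → Fin 3 → ℝ}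
    {h : ℝ → Fin N → Fin 3 → ℝ} (hJ : Admissible J₀ J h) {ψ : (m : ℕ) → Fin N → SiteSpace m}
    {Ψ : (m : ℕ) → ℝ → ChainSpace N m} {s₀ : Fin N → Fin 3 → ℝ}
    (hψ : ∀ m, 1 ≤ m → ∀ i, IsClassicalState (ψ m i))
    (hΨ0 : ∀ m, 1 ≤ m → Ψ m 0 = productState (ψ m))
    (hΨ : ∀ m, 1 ≤ m → IsSchrodingerSolution m J h (Ψ m))
    (hs₀ : ∀ i α, Tendsto (fun m => normalizedSpin (Ψ m 0) i α) atTop (𝓝 (s₀ i α))) :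
    (∀ i, ∑ α, s₀ i α ^ 2 = 1) ∧
    ∀ s, s 0 = s₀ → IsClassicalTrajectory J h s →
      ∀ t, 0 ≤ t → ∀ (n : ℕ) (i : Fin n → Fin N) (α : Fin n → Fin 3),
        Tendsto (fun m => normalizedCorrelation (Ψ m t) i α) atTop
          (𝓝 ((∏ k, s t (i k) (α k) : ℝ) : ℂ)) := by
  have hunit : ∀ i, ∑ α, s₀ i α ^ 2 = 1 := fun i => by
    have h1 : Tendsto (fun m => ∑ α, normalizedSpin (Ψ m 0) i α ^ 2) atTop
        (𝓝 (∑ α, s₀ i α ^ 2)) := tendsto_finsetSum _ fun α _ => (hs₀ i α).pow 2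
    refine tendsto_nhds_unique h1 (tendsto_const_nhds.congr' ?_)
    filter_upwards [eventually_ge_atTop 1] with m hm
    rw [hΨ0 m hm, sum_normalizedSpin_productState_sq hm (hψ m hm)]
  refine ⟨hunit, fun s hs0 hs t ht n i α => ?_⟩
  have hnorm : ∀ m, 1 ≤ m → ‖Ψ m 0‖ = 1 := fun m hm => by
    rw [hΨ0 m hm]
    exact norm_productState fun i => (hψ m hm i).1
  -- With N fixed, the sum over sites serves as a common bound for the initial spreads.
  have hδ : Tendsto (fun m => ∑ i, spread s₀ (Ψ m 0) i) atTop (𝓝 0) := by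
    suffices H : ∀ i, Tendsto (fun m => spread s₀ (Ψ m 0) i) atTop (𝓝 0) by
      simpa using tendsto_finsetSum Finset.univ fun i _ => H i
    intro i
    have h1 : Tendsto (fun m => 2 + 1 / spinVal m -
        2 * ∑ α, s₀ i α * normalizedSpin (Ψ m 0) i α) atTop
        (𝓝 (2 + 0 - 2 * ∑ α, s₀ i α * s₀ i α)) :=
      (tendsto_one_div_spinVal.const_add 2).sub
        ((tendsto_finsetSum _ fun α _ => (hs₀ i α).const_mul (s₀ i α)).const_mul 2)
    have h2 : 2 + 0 - 2 * ∑ α, s₀ i α * s₀ i α = 0 := by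
      simp only [← sq, hunit i]
      norm_num
    rw [h2] at h1
    refine h1.congr' ?_
    filter_upwards [eventually_ge_atTop 1] with m hm
    rw [spread_eq_normalizedSpin hm (hnorm m hm) (hunit i)]
  rw [tendsto_iff_norm_sub_tendsto_zero]
  refine squeeze_zero' (Eventually.of_forall fun m => norm_nonneg _) ?_
    (tendsto_mul_sqrt_mul hδ (n * 2 ^ n) (Real.exp (4 * |J₀| * t)))
  filter_upwards [eventually_ge_atTop 1] with m hm
  refine norm_correlation_sub_le hm hJ (hΨ m hm) hs (hnorm m hm) (by rw [hs0]; exact hunit)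
    (Finset.sum_nonneg fun i _ => spread_nonneg _ _ _) (fun i => ?_) ht i α
  rw [hs0]
  exact Finset.single_le_sum (f := fun i => spread s₀ (Ψ m 0) i)
    (fun i _ => spread_nonneg _ _ _) (Finset.mem_univ i)

end LargeSpin

end

/-- Spins `S = m / 2`, `m → ∞`. The first part is the limit for a given system, the second its
uniformity over all systems with the same bound `J₀` and over bounded time intervals. -/
theorem mainTheorem1 (J₀ : ℝ) :
    (∀ (N : ℕ) (J : ℝ → Fin N → Fin N → Fin 3 → Fin 3 → ℝ) (h : ℝ → Fin N → Fin 3 → ℝ),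
      LargeSpin.Admissible J₀ J h →
      ∀ (ψ : (m : ℕ) → Fin N → LargeSpin.SiteSpace m)
        (Ψ : (m : ℕ) → ℝ → LargeSpin.ChainSpace N m)
        (s₀ : Fin N → Fin 3 → ℝ),
      (∀ m, 1 ≤ m → ∀ i, LargeSpin.IsClassicalState (ψ m i)) →
      (∀ m, 1 ≤ m → Ψ m 0 = LargeSpin.productState (ψ m)) →
      (∀ m, 1 ≤ m → LargeSpin.IsSchrodingerSolution m J h (Ψ m)) →
      (∀ i α, Tendsto (fun m => LargeSpin.normalizedSpin (Ψ m 0) i α) atTop (𝓝 (s₀ i α))) →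
      ∃ s : ℝ → Fin N → Fin 3 → ℝ,
        s 0 = s₀ ∧
        LargeSpin.IsClassicalTrajectory J h s ∧
        (∀ s' : ℝ → Fin N → Fin 3 → ℝ, LargeSpin.IsClassicalTrajectory J h s' → s' 0 = s₀ →
          ∀ t, 0 ≤ t → s' t = s t) ∧
        (∀ t, 0 ≤ t →
          (∀ i j α β, ContinuousWithinAt (fun u => J u i j α β) (Set.Ici 0) t) →
          (∀ i α, ContinuousWithinAt (fun u => h u i α) (Set.Ici 0) t) →
          ∀ i, HasDerivWithinAt (fun u => s u i)
            (LargeSpin.torque (J t) (h t) (s t) i) (Set.Ici 0) t) ∧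
        (∀ t, 0 ≤ t → ∀ i α,
          Tendsto (fun m => LargeSpin.normalizedSpin (Ψ m t) i α) atTop (𝓝 (s t i α))) ∧
        (∀ t, 0 ≤ t → ∀ (n : ℕ) (i : Fin n → Fin N) (α : Fin n → Fin 3),
          Tendsto (fun m => LargeSpin.normalizedCorrelation (Ψ m t) i α) atTop
            (𝓝 (((∏ k, s t (i k) (α k) : ℝ)) : ℂ)))) ∧
    (∀ (n : ℕ) (T ε : ℝ), 0 < ε →
      ∃ m₀ : ℕ, ∀ m, m₀ ≤ m → 1 ≤ m →
      ∀ (N : ℕ) (J : ℝ → Fin N → Fin N → Fin 3 → Fin 3 → ℝ) (h : ℝ → Fin N → Fin 3 → ℝ),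
      LargeSpin.Admissible J₀ J h →
      ∀ (ψ : Fin N → LargeSpin.SiteSpace m) (Ψ : ℝ → LargeSpin.ChainSpace N m)
        (s : ℝ → Fin N → Fin 3 → ℝ),
      (∀ i, LargeSpin.IsClassicalState (ψ i)) →
      Ψ 0 = LargeSpin.productState ψ →
      LargeSpin.IsSchrodingerSolution m J h Ψ →
      LargeSpin.IsClassicalTrajectory J h s →
      (∀ i α, s 0 i α = LargeSpin.normalizedSpin (Ψ 0) i α) →
      ∀ t, 0 ≤ t → t ≤ T → ∀ (i : Fin n → Fin N) (α : Fin n → Fin 3),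
        ‖LargeSpin.normalizedCorrelation (Ψ t) i α - (((∏ k, s t (i k) (α k) : ℝ)) : ℂ)‖
          ≤ ε) := by
  refine ⟨fun N J h hJ ψ Ψ s₀ hψ hΨ0 hΨ hs₀ => ?_, fun n T ε hε =>
    LargeSpin.correlation_uniform_bound J₀ n T hε⟩
  obtain ⟨hunit, hlim⟩ := LargeSpin.classical_limit hJ hψ hΨ0 hΨ hs₀
  obtain ⟨s, hs0, hs⟩ := LargeSpin.exists_isClassicalTrajectory hJ hunit
  refine ⟨s, hs0, hs, fun s' hs' hs'0 t ht => ?_, fun t ht hJt hht i => ?_, fun t ht i α => ?_,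
    hlim s hs0 hs⟩
  · exact hs.unique hJ hs' (hs'0.trans hs0.symm) (by rw [hs0]; exact hunit) ht
  · exact hs.hasDerivWithinAt hJ ht hJt hht i
  · have h1 := (Complex.continuous_re.tendsto _).comp
      (hlim s hs0 hs t ht 1 (fun _ => i) fun _ => α)
    simpa [Function.comp_def, LargeSpin.normalizedCorrelation_one] using h1
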